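/- Consider one transmission round of vector coded caching. A base station with $L$ antennas and total power budget $P_{\rm tot}>0$ simultaneously serves $G\ge 1$ user groups forming a set $\Psi$, $|\Psi|=G$, with $Q\ge 1$ users in each group. User $k\in[Q]$ of group $\psi\in\Psi$ has $M_{\psi,k}\ge 1$ antennas and is sent $M_{\psi,k}$ independent unit-power symbols, with powers $P_{\psi,k,q}\ge 0$. Let $M_\psi=\sum_{k}M_{\psi,k}$ and assume $L>M_\psi$ for every $\psi\in\Psi$. The channel matrices $H_{\psi,k}\in\mathbb{C}^{L\times M_{\psi,k}}$ have independent entries (independent Rayleigh fading), those of $H_{\psi,k}$ having law $\mathcal{CN}(0,\beta_{\psi,k})$ with pathloss $\beta_{\psi,k}>0$, and the noise at each antenna has power $N_0>0$. With $H_\psi=[H_{\psi,1},\dots,H_{\psi,Q}]$, the zero-forcing precoder of group $\psi$ is $V_\psi=H_\psi^*(H_\psi^TH_\psi^*)^{-1}$ with each column scaled to unit norm. Interference from the other groups is cancelled by means of the cached content, and every user decodes each symbol from the corresponding antenna. The fading-averaged effective rate of user $(\psi,k)$ is $$\bar R_{\psi,k}=\xi_{G,Q}\,\mathbb{E}\Big[\sum_{q=1}^{M_{\psi,k}}\ln(1+\mathrm{SINR}_{\psi,k,q})\Big],\qquad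 \xi_{G,Q}=1-\frac{\Theta}{T}\sum_{\psi\in\Psi}\sum_{k\in[Q]}M_{\psi,k},$$ where $T>0$ is the coherence block period, $\Theta\ge 0$ is the number of pilot symbols per receive antenna and block, and $\xi_{G,Q}>0$. Let $\bar R^\star_{\rm ZF}$ be the sum $\sum_{\psi,k}\bar R_{\psi,k}$ at a power allocation that does not depend on the fading and maximizes $\min_{\psi,k}\bar R_{\psi,k}$ subject to $\sum_{\psi,k,q}P_{\psi,k,q}\le P_{\rm tot}$ (max-min fairness, MMF). Then the averages are finite, such an allocation exists, and $\bar R^\star_{\rm ZF}$ is the same for all such allocations. Moreover $$\widetilde R^\star_{\rm ZF}\le\bar R^\star_{\rm ZF}\le\widehat R^\star_{\rm ZF},$$ where $\widetilde R^\star_{\rm ZF}$ and $\widehat R^\star_{\rm ZF}$ are the unique real solutions of, respectively, $$\sum_{\psi\in\Psi}\sum_{k\in[Q]}\frac{N_0M_{\psi,k}\Big(\exp\Big(\frac{\widetilde R^\star_{\rm ZF}}{\xi_{G,Q}GQM_{\psi,k}}\Big)-1\Big)}{\beta_{\psi,k}(L-M_\psi)}=P_{\rm tot},$$ $$\sum_{\psi\in\Psi}\sum_{k\in[Q]}\frac{N_0M_{\psi,k}\Big(\exp\Big(\frac{\widehat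 R^\star_{\rm ZF}}{\xi_{G,Q}GQM_{\psi,k}}\Big)-1\Big)}{\beta_{\psi,k}(L-M_\psi+1)}=P_{\rm tot}.$$ If $M_{\psi,k}=M$ for all $\psi\in\Psi$ and $k\in[Q]$, then $$\widetilde R^\star_{\rm ZF}=\xi_{G,Q}GQM\ln\Big(1+\frac{P_{\rm tot}(L-QM)}{MN_0\sum_{\psi\in\Psi}\sum_{k\in[Q]}\beta_{\psi,k}^{-1}}\Big),\qquad \widehat R^\star_{\rm ZF}=\xi_{G,Q}GQM\ln\Big(1+\frac{P_{\rm tot}(L-QM+1)}{MN_0\sum_{\psi\in\Psi}\sum_{k\in[Q]}\beta_{\psi,k}^{-1}}\Big).$$ -/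

import Mathlib

open MeasureTheory ProbabilityTheory
open scoped Matrix BigOperators

noncomputable section

/-- Parameters of one transmission round of vector coded caching. `Ψ` is the set of the user
groups served in the round (so `G = |Ψ|`), and `Q` users are served in each group. -/
structure VCCParams (Ψ : Type*) where
  /-- number of transmit antennas -/
  L : ℕ
  /-- number of served users per group -/
  Q : ℕ
  /-- number of receive antennas of each served user (also the number of symbols sent to it) -/
  M : Ψ → Fin Q → ℕ
  /-- large-scale fading / pathloss of each served user -/
  β : Ψ → Fin Q → ℝ
  /-- noise power -/
  N₀ : ℝ
  /-- maximum allowable transmit power -/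
  Ptot : ℝ
  /-- coherence block period, in symbols -/
  T : ℝ
  /-- number of pilot symbols per receive antenna and per coherence block -/
  Θ : ℝ

namespace VCCParams

variable {Ψ : Type*} (p : VCCParams Ψ)

/-- The number `G` of groups served simultaneously. -/
def G [Fintype Ψ] : ℕ := Fintype.card Ψ

/-- The total number `M_ψ` of active receive antennas in group `ψ`. -/
def Mgrp (ψ : Ψ) : ℕ := ∑ k, p.M ψ k

/-- The factor `ξ_{G,Q} = 1 - Θ (∑ M_{ψ,k}) / T` accounting for the CSI costs. -/
def ξ [Fintype Ψ] : ℝ := 1 - p.Θ * (∑ ψ, ∑ k, (p.M ψ k : ℝ)) / p.T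

/-- The symbol streams of group `ψ`: the `q`-th symbol of the `k`-th user. -/
abbrev Stream (ψ : Ψ) : Type := (k : Fin p.Q) × Fin (p.M ψ k)

/-- A realization of all channel matrices `H_{ψ,k} ∈ ℂ^{L × M_{ψ,k}}`. -/
abbrev Channel : Type _ := (ψ : Ψ) → (k : Fin p.Q) → Matrix (Fin p.L) (Fin (p.M ψ k)) ℂ

/-- A power allocation: the power `P_{ψ,k,q}` of each symbol. -/
abbrev Power : Type _ := (ψ : Ψ) → (k : Fin p.Q) → Fin (p.M ψ k) → ℝ

/-- The circularly symmetric complex Gaussian law `CN(0, v)` on `ℂ`: independent real and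
imaginary parts, each centred of variance `v / 2`. -/
def complexGaussian (v : ℝ) : Measure ℂ :=
  ((gaussianReal 0 (v / 2).toNNReal).prod (gaussianReal 0 (v / 2).toNNReal)).map
    Complex.measurableEquivRealProd.symm

/-- Independent Rayleigh fading with pathloss: all channel coefficients are independent and the
entries of `H_{ψ,k}` have law `CN(0, β_{ψ,k})`. -/
structure IsRayleigh {Ω : Type*} [MeasurableSpace Ω] (μ : Measure Ω) (H : Ω → p.Channel) :
    Prop where
  law : ∀ ψ k i q, HasLaw (fun ω => H ω ψ k i q) (complexGaussian (p.β ψ k)) μ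
  indep : iIndepFun
    (fun (c : (ψ : Ψ) × (k : Fin p.Q) × Fin p.L × Fin (p.M ψ k)) ω =>
      H ω c.1 c.2.1 c.2.2.1 c.2.2.2) μ

/-- The group channel matrix `H_ψ = [H_{ψ,1}, …, H_{ψ,Q}] ∈ ℂ^{L × M_ψ}`. -/
def groupChannel (h : p.Channel) (ψ : Ψ) : Matrix (Fin p.L) (p.Stream ψ) ℂ :=
  Matrix.of fun i s => h ψ s.1 i s.2

/-- `(H_ψᵀ H_ψ^*)⁻¹`, where `^*` is entrywise conjugation. -/
def gramInv (h : p.Channel) (ψ : Ψ) : Matrix (p.Stream ψ) (p.Stream ψ) ℂ :=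
  ((p.groupChannel h ψ)ᵀ * (p.groupChannel h ψ).map star)⁻¹

/-- The matrix `D_ψ` normalizing the columns of the precoder: all entries of its column `s` are
`([(H_ψᵀ H_ψ^*)⁻¹]_{s,s})^{-1/2}`. -/
def zfNormalization (h : p.Channel) (ψ : Ψ) : Matrix (Fin p.L) (p.Stream ψ) ℂ :=
  Matrix.of fun _ s => (((Real.sqrt (p.gramInv h ψ s s).re)⁻¹ : ℝ) : ℂ)

/-- The zero-forcing precoder `V_ψ = (H_ψ^* (H_ψᵀ H_ψ^*)⁻¹) ∘ D_ψ` (`∘` the Hadamard product). -/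
def zfPrecoder (h : p.Channel) (ψ : Ψ) : Matrix (Fin p.L) (p.Stream ψ) ℂ :=
  ((p.groupChannel h ψ).map star * p.gramInv h ψ) ⊙ p.zfNormalization h ψ

/-- The coefficients `H_ψᵀ V_ψ` of the effective channel in group `ψ`: the entry `(s, s')` is the
gain of the unit-power symbol `s'` at the receive antenna that decodes the symbol `s` (the
receivers use the identity as decoding matrix). -/
def effChannel (h : p.Channel) (ψ : Ψ) : Matrix (p.Stream ψ) (p.Stream ψ) ℂ :=
  (p.groupChannel h ψ)ᵀ * p.zfPrecoder h ψ

/-- The SINR for decoding stream `s` of group `ψ`, after the signals of the other groups, which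
are known from the cached content, have been removed from the received signal. -/
def sinr (P : p.Power) (h : p.Channel) (ψ : Ψ) (s : p.Stream ψ) : ℝ :=
  P ψ s.1 s.2 * ‖p.effChannel h ψ s s‖ ^ 2 /
    (p.N₀ + ∑ s' ∈ Finset.univ.erase s, P ψ s'.1 s'.2 * ‖p.effChannel h ψ s s'‖ ^ 2)

variable [Fintype Ψ]

/-- The instantaneous effective rate (nats/s/Hz) of the `k`-th user of group `ψ`. -/
def userRate (P : p.Power) (h : p.Channel) (ψ : Ψ) (k : Fin p.Q) : ℝ :=
  p.ξ * ∑ q, Real.log (1 + p.sinr P h ψ ⟨k, q⟩)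

variable {Ω : Type*} [MeasurableSpace Ω] (μ : Measure Ω) (H : Ω → p.Channel)

/-- The effective rate of a user, averaged over the channel fading. -/
def avgUserRate (P : p.Power) (ψ : Ψ) (k : Fin p.Q) : ℝ :=
  ∫ ω, p.userRate P (H ω) ψ k ∂μ

/-- The fading-averaged effective sum-rate over all `G Q` served users. -/
def avgSumRate (P : p.Power) : ℝ := ∑ ψ, ∑ k, p.avgUserRate μ H P ψ k

/-- The smallest fading-averaged effective rate among the `G Q` served users. -/
def minAvgRate (P : p.Power) : ℝ := ⨅ u : Ψ × Fin p.Q, p.avgUserRate μ H P u.1 u.2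

/-- The admissible power allocations: nonnegative powers of total at most `P_tot`. -/
def Feasible (P : p.Power) : Prop :=
  (∀ ψ k q, 0 ≤ P ψ k q) ∧ ∑ ψ, ∑ k, ∑ q, P ψ k q ≤ p.Ptot

/-- `P` solves the max-min fairness (MMF) problem for the fading-averaged rates: it maximizes the
minimum rate of the served users among all admissible (fading-independent) allocations. -/
def IsMMFOptimal (P : p.Power) : Prop :=
  p.Feasible P ∧ ∀ P', p.Feasible P' → p.minAvgRate μ H P' ≤ p.minAvgRate μ H P

/-- `R` is an MMF-optimized fading-averaged effective sum-rate: the sum-rate attained by a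
solution of the MMF problem. -/
def IsMMFSumRate (R : ℝ) : Prop := ∃ P, p.IsMMFOptimal μ H P ∧ p.avgSumRate μ H P = R

/-- The equation that defines the lower bound. -/
def LowerEq (R : ℝ) : Prop :=
  ∑ ψ, ∑ k, p.N₀ * p.M ψ k * (Real.exp (R / (p.ξ * G (Ψ := Ψ) * p.Q * p.M ψ k)) - 1) /
    (p.β ψ k * ((p.L : ℝ) - p.Mgrp ψ)) = p.Ptot

/-- The equation that defines the upper bound. -/
def UpperEq (R : ℝ) : Prop :=
  ∑ ψ, ∑ k, p.N₀ * p.M ψ k * (Real.exp (R / (p.ξ * G (Ψ := Ψ) * p.Q * p.M ψ k)) - 1) /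
    (p.β ψ k * ((p.L : ℝ) - p.Mgrp ψ + 1)) = p.Ptot

end VCCParams

end

/-! ### Moments and projections of complex Gaussian vectors. -/

noncomputable section

namespace VCCParams

open scoped ENNReal NNReal

/-! Zero forcing removes all interference inside a group, and the SINR of a stream becomes `P / N₀`
times a gain `X`: the squared distance of its channel vector to the span of the other vectors of its
group (`gram_inv_diag_eq`, `sinr_eq`). Given the others, that vector is still isotropic Gaussian,
and almost surely it is projected onto a space of dimension `d = L - M_ψ + 1`. Hence `𝔼 X = β d` and
`𝔼 X⁻¹ = 1 / (β (d - 1))`. Jensen's inequality for the concave `x ↦ log (1 + a x)` and for the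
convex `y ↦ log (1 + a / y)` at `y = X⁻¹` encloses the mean rate of a stream between the rates with
deterministic gains `β (L - M_ψ)` and `β (L - M_ψ + 1)` (`le_streamRate`, `streamRate_le`).

Mean rates are continuous and strictly increasing in the power, so compactness gives an optimal
allocation, and moving power between users shows that all users have the same rate there
(`eq_iInf_of_maxMin`). The sum-rate is therefore `G Q` times the optimal minimum, which is the same
for all optimizers.

Both bounds compare powers through the increasing function `requiredPower`. For the lower one, the
power that suffices under the pessimistic gains is an admissible allocation
(`exists_feasible_le_minAvgRate`). For the upper one, an optimal allocation spends at least what its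
rates require under the optimistic gains (`requiredPower_avgSumRate_le`). -/

instance isProbabilityMeasure_complexGaussian (v : ℝ) :
    IsProbabilityMeasure (complexGaussian v) :=
  Measure.isProbabilityMeasure_map Complex.measurableEquivRealProd.symm.measurable.aemeasurable

lemma charFun_complexGaussian {v : ℝ} (hv : 0 ≤ v) (t : ℂ) :
    charFun (complexGaussian v) t = Complex.exp (-(v * ‖t‖ ^ 2 / 4 : ℝ)) := by
  rw [charFun_apply, complexGaussian, integral_map (by fun_prop) (by fun_prop)]
  have h : ∀ x : ℝ × ℝ, Complex.exp (inner ℝ (Complex.measurableEquivRealProd.symm x) t *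
      Complex.I) = Complex.exp (t.re * x.1 * Complex.I) * Complex.exp (t.im * x.2 * Complex.I) := by
    intro x
    rw [← Complex.exp_add]
    congr 1
    simp [Complex.inner, Complex.measurableEquivRealProd_symm_apply]
    ring
  simp_rw [h]
  rw [integral_prod_mul (fun x : ℝ => Complex.exp (t.re * x * Complex.I))
    (fun x : ℝ => Complex.exp (t.im * x * Complex.I)), ← charFun_apply_real, ← charFun_apply_real,
    charFun_gaussianReal, charFun_gaussianReal, ← Complex.exp_add]
  congr 1
  have h2 : ((v / 2).toNNReal : ℝ) = v / 2 := Real.coe_toNNReal _ (by positivity)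
  have h3 : (((v / 2).toNNReal : ℝ) : ℂ) = v / 2 := by rw [h2]; simp
  rw [h3, Complex.sq_norm, Complex.normSq_apply]
  push_cast
  ring

lemma lintegral_exp_neg_mul_sq_gaussianReal {v : ℝ} (hv : 0 < v) {t : ℝ} (ht : 0 ≤ t) :
    ∫⁻ x, ENNReal.ofReal (Real.exp (-(t * x ^ 2))) ∂gaussianReal 0 v.toNNReal =
      ENNReal.ofReal (1 / √(1 + 2 * v * t)) := by
  have hv0 : v.toNNReal ≠ 0 := by simpa using hv
  have hvc : (v.toNNReal : ℝ) = v := Real.coe_toNNReal _ hv.le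
  rw [← ofReal_integral_eq_lintegral_ofReal]
  · congr 1
    rw [integral_gaussianReal_eq_integral_smul hv0]
    have : ∀ x : ℝ, gaussianPDFReal 0 v.toNNReal x • Real.exp (-(t * x ^ 2)) =
        (√(2 * Real.pi * v))⁻¹ * Real.exp (-(1 / (2 * v) + t) * x ^ 2) := by
      intro x
      rw [gaussianPDFReal, hvc, smul_eq_mul, mul_assoc, ← Real.exp_add]
      congr 2
      field_simp
      ring
    simp_rw [this]
    rw [integral_const_mul, integral_gaussian, ← Real.sqrt_inv, ← Real.sqrt_mul (by positivity),
      one_div (√_), ← Real.sqrt_inv]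
    congr 1
    field_simp
  · refine Integrable.of_bound (C := 1) (by fun_prop) (ae_of_all _ fun x => ?_)
    rw [Real.norm_eq_abs, Real.abs_exp, Real.exp_le_one_iff]
    nlinarith [mul_nonneg ht (sq_nonneg x)]
  · exact ae_of_all _ fun x => (Real.exp_pos _).le

/-- The real and imaginary parts, of variance `v / 2` each, contribute one factor `(1 + v t)^(-1/2)`
each. -/
lemma lintegral_exp_neg_mul_normSq_complexGaussian {v : ℝ} (hv : 0 < v) {t : ℝ} (ht : 0 ≤ t) :
    ∫⁻ z, ENNReal.ofReal (Real.exp (-(t * ‖z‖ ^ 2))) ∂complexGaussian v =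
      ENNReal.ofReal (1 / (1 + v * t)) := by
  rw [complexGaussian, lintegral_map (by fun_prop) (by fun_prop)]
  have h : ∀ x : ℝ × ℝ, ENNReal.ofReal
      (Real.exp (-(t * ‖Complex.measurableEquivRealProd.symm x‖ ^ 2))) =
      ENNReal.ofReal (Real.exp (-(t * x.1 ^ 2))) * ENNReal.ofReal (Real.exp (-(t * x.2 ^ 2))) := by
    intro x
    rw [← ENNReal.ofReal_mul (Real.exp_pos _).le, ← Real.exp_add, Complex.sq_norm,
      Complex.normSq_apply, Complex.measurableEquivRealProd_symm_apply]
    congr 2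
    ring
  simp_rw [h]
  rw [lintegral_prod_mul (f := fun x : ℝ => ENNReal.ofReal (Real.exp (-(t * x ^ 2))))
    (g := fun x : ℝ => ENNReal.ofReal (Real.exp (-(t * x ^ 2)))) (by fun_prop) (by fun_prop),
    lintegral_exp_neg_mul_sq_gaussianReal (by positivity) ht,
    ← ENNReal.ofReal_mul (by positivity)]
  congr 1
  have : 0 ≤ 1 + 2 * (v / 2) * t := by positivity
  rw [one_div, ← mul_inv, Real.mul_self_sqrt this, one_div]
  congr 2
  ring

lemma lintegral_sq_gaussianReal {v : ℝ} (hv : 0 ≤ v) :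
    ∫⁻ x, ENNReal.ofReal (x ^ 2) ∂gaussianReal 0 v.toNNReal = ENNReal.ofReal v := by
  have hm : MemLp (id : ℝ → ℝ) 2 (gaussianReal 0 v.toNNReal) := memLp_id_gaussianReal 2
  have hi : Integrable (fun x : ℝ => x ^ 2) (gaussianReal 0 v.toNNReal) := hm.integrable_sq
  rw [← ofReal_integral_eq_lintegral_ofReal hi (ae_of_all _ fun x => sq_nonneg _)]
  congr 1
  have h := variance_eq_sub (μ := gaussianReal 0 v.toNNReal) hm
  rw [variance_id_gaussianReal] at h
  simp only [id_eq, integral_id_gaussianReal, Real.coe_toNNReal v hv] at h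
  simpa using h.symm

lemma lintegral_normSq_complexGaussian {v : ℝ} (hv : 0 ≤ v) :
    ∫⁻ z, ENNReal.ofReal (‖z‖ ^ 2) ∂complexGaussian v = ENNReal.ofReal v := by
  rw [complexGaussian, lintegral_map (by fun_prop) (by fun_prop)]
  have h : ∀ x : ℝ × ℝ, ENNReal.ofReal (‖Complex.measurableEquivRealProd.symm x‖ ^ 2) =
      ENNReal.ofReal (x.1 ^ 2) + ENNReal.ofReal (x.2 ^ 2) := by
    intro x
    rw [← ENNReal.ofReal_add (sq_nonneg _) (sq_nonneg _), Complex.sq_norm,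
      Complex.normSq_apply, Complex.measurableEquivRealProd_symm_apply]
    congr 1
    ring
  simp_rw [h]
  rw [lintegral_add_left (by fun_prop), lintegral_prod _ (by fun_prop),
    lintegral_prod _ (by fun_prop)]
  simp only [lintegral_const, measure_univ, mul_one]
  rw [lintegral_sq_gaussianReal (by positivity), ← ENNReal.ofReal_add (by positivity)
    (by positivity)]
  congr 1
  ring

/-- The law of a vector with independent `CN(0, v)` coordinates. -/
def complexGaussianVec (n : ℕ) (v : ℝ) : Measure (EuclideanSpace ℂ (Fin n)) :=
  (Measure.pi fun _ : Fin n => complexGaussian v).map (WithLp.toLp 2)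

instance isProbabilityMeasure_complexGaussianVec (n : ℕ) (v : ℝ) :
    IsProbabilityMeasure (complexGaussianVec n v) :=
  Measure.isProbabilityMeasure_map (by fun_prop)

/-- Dependence on `‖t‖` alone is the isotropy that identifies the laws of projections below. -/
lemma charFun_complexGaussianVec (n : ℕ) {v : ℝ} (hv : 0 ≤ v) (t : EuclideanSpace ℂ (Fin n)) :
    charFun (complexGaussianVec n v) t = Complex.exp (-(v * ‖t‖ ^ 2 / 4 : ℝ)) := by
  rw [complexGaussianVec, charFun_pi]
  simp_rw [charFun_complexGaussian hv, ← Complex.exp_sum]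
  congr 1
  rw [EuclideanSpace.norm_sq_eq]
  push_cast
  rw [Finset.sum_neg_distrib, ← Finset.sum_div, ← Finset.mul_sum]

lemma lintegral_pi_prod {ι : Type*} [Fintype ι] {α : ι → Type*} [∀ i, MeasurableSpace (α i)]
    (m : ∀ i, Measure (α i)) [∀ i, IsProbabilityMeasure (m i)] (f : ∀ i, α i → ℝ≥0∞)
    (hf : ∀ i, Measurable (f i)) :
    ∫⁻ x, ∏ i, f i (x i) ∂Measure.pi m = ∏ i, ∫⁻ y, f i y ∂m i := by
  rw [lintegral_prod_eq_prod_lintegral_of_indepFun (μ := Measure.pi m) Finset.univ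
    (fun i x => f i (x i))
    (iIndepFun_pi (X := f) fun i => (hf i).aemeasurable)
    (fun i => (hf i).comp (measurable_pi_apply i))]
  refine Finset.prod_congr rfl fun i _ => ?_
  rw [← (measurePreserving_eval m i).lintegral_comp (hf i)]

lemma lintegral_normSq_complexGaussianVec (n : ℕ) {v : ℝ} (hv : 0 ≤ v) :
    ∫⁻ h, ENNReal.ofReal (‖h‖ ^ 2) ∂complexGaussianVec n v = ENNReal.ofReal (v * n) := by
  rw [complexGaussianVec, lintegral_map (by fun_prop) (by fun_prop)]
  simp_rw [EuclideanSpace.norm_sq_eq, ENNReal.ofReal_sum_of_nonneg fun i _ => sq_nonneg _]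
  rw [lintegral_finsetSum _ (fun i _ => by fun_prop)]
  have : ∀ i : Fin n, ∫⁻ x : Fin n → ℂ, ENNReal.ofReal (‖x i‖ ^ 2)
      ∂Measure.pi (fun _ : Fin n => complexGaussian v) = ENNReal.ofReal v := by
    intro i
    rw [← lintegral_normSq_complexGaussian hv, ← (measurePreserving_eval
      (fun _ : Fin n => complexGaussian v) i).lintegral_comp
      (f := fun z : ℂ => ENNReal.ofReal (‖z‖ ^ 2)) (by fun_prop)]
  simp only [this, Finset.sum_const, Finset.card_univ, Fintype.card_fin, nsmul_eq_mul]
  rw [mul_comm v, ENNReal.ofReal_mul (by positivity), ENNReal.ofReal_natCast]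

lemma lintegral_exp_neg_mul_normSq_complexGaussianVec (n : ℕ) {v : ℝ} (hv : 0 < v) {t : ℝ}
    (ht : 0 ≤ t) :
    ∫⁻ h, ENNReal.ofReal (Real.exp (-(t * ‖h‖ ^ 2))) ∂complexGaussianVec n v =
      ENNReal.ofReal ((1 + v * t) ^ (-(n : ℝ))) := by
  rw [complexGaussianVec, lintegral_map (by fun_prop) (by fun_prop)]
  simp_rw [EuclideanSpace.norm_sq_eq, Finset.mul_sum, ← Finset.sum_neg_distrib, Real.exp_sum,
    ENNReal.ofReal_prod_of_nonneg fun i _ => (Real.exp_pos _).le]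
  rw [lintegral_pi_prod (fun _ : Fin n => complexGaussian v)
    (fun _ z => ENNReal.ofReal (Real.exp (-(t * ‖z‖ ^ 2)))) (fun i => by fun_prop)]
  simp only [lintegral_exp_neg_mul_normSq_complexGaussian hv ht, Finset.prod_const,
    Finset.card_univ, Fintype.card_fin]
  rw [← ENNReal.ofReal_pow (by positivity), Real.rpow_neg (by positivity), Real.rpow_natCast,
    one_div, inv_pow]

/-- Turns an inverse moment into an integral of Laplace transforms. At `x = 0` both sides are `∞`,
so no null set has to be excluded. -/
lemma lintegral_Ioi_exp_neg_mul (x : ℝ) (hx : 0 ≤ x) :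
    ∫⁻ t in Set.Ioi (0 : ℝ), ENNReal.ofReal (Real.exp (-(t * x))) = (ENNReal.ofReal x)⁻¹ := by
  rcases hx.eq_or_lt with rfl | hx
  · simp
  have h := integrableOn_exp_mul_Ioi (a := -x) (by linarith) 0
  have h2 := integral_exp_mul_Ioi (a := -x) (by linarith) 0
  rw [← ofReal_integral_eq_lintegral_ofReal
    (by refine h.congr (ae_of_all _ fun t => ?_); simp only; congr 1; ring)
    (ae_of_all _ fun _ => (Real.exp_pos _).le), ← ENNReal.ofReal_inv_of_pos hx]
  congr 1
  have : ∀ t : ℝ, Real.exp (-(t * x)) = Real.exp (-x * t) := fun t => by congr 1; ring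
  simp_rw [this, h2]
  simp [neg_div_neg_eq]

lemma lintegral_Ioi_one_add_mul_rpow {v s : ℝ} (hv : 0 < v) (hs : 1 < s) :
    ∫⁻ t in Set.Ioi (0 : ℝ), ENNReal.ofReal ((1 + v * t) ^ (-s)) =
      ENNReal.ofReal (1 / (v * (s - 1))) := by
  have hd : ∀ t ∈ Set.Ici (0 : ℝ), HasDerivAt
      (fun t : ℝ => -(1 / (v * (s - 1))) * (1 + v * t) ^ (1 - s)) ((1 + v * t) ^ (-s)) t := by
    intro t ht
    have hp : 0 < 1 + v * t := by have : 0 ≤ t := ht; positivity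
    have h1 : HasDerivAt (fun t : ℝ => 1 + v * t) v t := by
      simpa using ((hasDerivAt_id t).const_mul v).const_add 1
    have h2 := (h1.rpow_const (p := 1 - s) (Or.inl hp.ne')).const_mul (-(1 / (v * (s - 1))))
    have h3 : s - 1 ≠ 0 := by linarith
    have h4 : -(1 / (v * (s - 1))) * (v * (1 - s) * (1 + v * t) ^ (1 - s - 1)) =
        (1 + v * t) ^ (-s) := by
      rw [show 1 - s - 1 = -s by ring]
      field_simp
      ring
    rwa [h4] at h2
  have hlim : Filter.Tendsto (fun t : ℝ => -(1 / (v * (s - 1))) * (1 + v * t) ^ (1 - s))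
      Filter.atTop (nhds 0) := by
    have h1 : Filter.Tendsto (fun t : ℝ => 1 + v * t) Filter.atTop Filter.atTop :=
      Filter.tendsto_atTop_add_const_left _ _ (Filter.tendsto_id.const_mul_atTop hv)
    have h2 := (tendsto_rpow_neg_atTop (y := s - 1) (by linarith)).comp h1
    simpa using (h2.const_mul (-(1 / (v * (s - 1)))))
  have hnn : ∀ t ∈ Set.Ioi (0 : ℝ), 0 ≤ (1 + v * t) ^ (-s) := by
    intro t ht
    have : 0 < t := ht
    positivity
  have hi := integrableOn_Ioi_deriv_of_nonneg' hd hnn hlim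
  have he := integral_Ioi_of_hasDerivAt_of_nonneg' hd hnn hlim
  rw [← ofReal_integral_eq_lintegral_ofReal hi
    ((ae_restrict_iff' measurableSet_Ioi).2 (ae_of_all _ hnn)), he]
  simp

/-- By Tonelli this is the integral of `(1 + v t)^(-n)` over `t > 0`, which converges for `n ≥ 2`.
-/
lemma lintegral_inv_normSq_complexGaussianVec {n : ℕ} (hn : 2 ≤ n) {v : ℝ} (hv : 0 < v) :
    ∫⁻ h, (ENNReal.ofReal (‖h‖ ^ 2))⁻¹ ∂complexGaussianVec n v =
      ENNReal.ofReal (1 / (v * (n - 1))) := by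
  simp_rw [← fun h : EuclideanSpace ℂ (Fin n) => lintegral_Ioi_exp_neg_mul (‖h‖ ^ 2) (sq_nonneg _)]
  rw [lintegral_lintegral_swap (by fun_prop),
    ← lintegral_Ioi_one_add_mul_rpow hv (by exact_mod_cast hn)]
  refine setLIntegral_congr_fun measurableSet_Ioi fun t ht => ?_
  exact lintegral_exp_neg_mul_normSq_complexGaussianVec n hv (le_of_lt ht)

/-- The coordinates of the orthogonal projection of a vector with independent `CN(0, v)`
coordinates, in an orthonormal basis of the subspace, are again independent with law
`CN(0, v)`. -/
lemma map_repr_orthogonalProjection_complexGaussianVec {L : ℕ} {v : ℝ} (hv : 0 ≤ v)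
    (K : Submodule ℂ (EuclideanSpace ℂ (Fin L))) :
    (complexGaussianVec L v).map
      (fun h => (stdOrthonormalBasis ℂ K).repr (K.orthogonalProjectionOnto h)) =
      complexGaussianVec (Module.finrank ℂ K) v := by
  have hmeas : Measurable
      (fun h => (stdOrthonormalBasis ℂ K).repr (K.orthogonalProjectionOnto h)) := by
    refine Continuous.measurable ?_
    fun_prop
  have := Measure.isProbabilityMeasure_map (μ := complexGaussianVec L v) hmeas.aemeasurable
  refine Measure.ext_of_charFun (funext fun t => ?_)
  have hre : ∀ {m : ℕ} (x y : EuclideanSpace ℂ (Fin m)), inner ℝ x y = (inner ℂ x y).re := by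
    intro m x y
    simp [PiLp.inner_apply, Complex.inner]
  rw [charFun_complexGaussianVec _ hv, charFun_apply, integral_map hmeas.aemeasurable
    (by fun_prop)]
  -- The adjoint of the coordinate map is an isometric embedding, so the characteristic function at
  -- `t` is the original one at a point of the same norm.
  have key : ∀ h : EuclideanSpace ℂ (Fin L),
      inner ℝ ((stdOrthonormalBasis ℂ K).repr (K.orthogonalProjectionOnto h)) t =
      inner ℝ h (((stdOrthonormalBasis ℂ K).repr.symm t : K) : EuclideanSpace ℂ (Fin L)) := by
    intro h
    rw [hre, hre, ← LinearIsometryEquiv.inner_map_map (stdOrthonormalBasis ℂ K).repr.symm,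
      LinearIsometryEquiv.symm_apply_apply, Submodule.inner_orthogonalProjectionOnto_eq_of_mem_right]
  simp_rw [key]
  rw [← charFun_apply, charFun_complexGaussianVec _ hv, ← Submodule.coe_norm,
    LinearIsometryEquiv.norm_map]

lemma lintegral_normSq_orthogonalProjection {L : ℕ} {v : ℝ} (hv : 0 ≤ v)
    (K : Submodule ℂ (EuclideanSpace ℂ (Fin L))) :
    ∫⁻ h, ENNReal.ofReal (‖K.orthogonalProjectionOnto h‖ ^ 2) ∂complexGaussianVec L v =
      ENNReal.ofReal (v * Module.finrank ℂ K) := by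
  rw [← lintegral_normSq_complexGaussianVec _ hv,
    ← map_repr_orthogonalProjection_complexGaussianVec hv K,
    lintegral_map (by fun_prop) (Continuous.measurable (by fun_prop))]
  simp

lemma lintegral_inv_normSq_orthogonalProjection {L : ℕ} {v : ℝ} (hv : 0 < v)
    (K : Submodule ℂ (EuclideanSpace ℂ (Fin L))) (hK : 2 ≤ Module.finrank ℂ K) :
    ∫⁻ h, (ENNReal.ofReal (‖K.orthogonalProjectionOnto h‖ ^ 2))⁻¹ ∂complexGaussianVec L v =
      ENNReal.ofReal (1 / (v * (Module.finrank ℂ K - 1))) := by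
  rw [← lintegral_inv_normSq_complexGaussianVec hK hv,
    ← map_repr_orthogonalProjection_complexGaussianVec hv.le K,
    lintegral_map (by fun_prop) (Continuous.measurable (by fun_prop))]
  simp

end VCCParams

end

/-! ### Squared distance to a span: measurability, dimensions, Gram matrices. -/

noncomputable section

namespace VCCParams

open scoped ENNReal NNReal

/-- The squared distance of `h` to the span of the vectors `o j`. -/
def spanDistSq {L : ℕ} {J : Type*} [Finite J] (o : J → EuclideanSpace ℂ (Fin L))
    (h : EuclideanSpace ℂ (Fin L)) : ℝ :=
  ‖(Submodule.span ℂ (Set.range o))ᗮ.orthogonalProjectionOnto h‖ ^ 2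

lemma spanDistSq_nonneg {L : ℕ} {J : Type*} [Finite J] (o : J → EuclideanSpace ℂ (Fin L))
    (h : EuclideanSpace ℂ (Fin L)) : 0 ≤ spanDistSq o h := sq_nonneg _

lemma spanDistSq_eq_zero_of_mem {L : ℕ} {J : Type*} [Finite J]
    {o : J → EuclideanSpace ℂ (Fin L)} {h : EuclideanSpace ℂ (Fin L)}
    (hh : h ∈ Submodule.span ℂ (Set.range o)) : spanDistSq o h = 0 := by
  rw [spanDistSq, Submodule.orthogonalProjectionOnto_orthogonal_apply_eq_zero hh]
  simp

lemma ofReal_spanDistSq {L : ℕ} {J : Type*} [Fintype J] (o : J → EuclideanSpace ℂ (Fin L))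
    (h : EuclideanSpace ℂ (Fin L)) :
    ENNReal.ofReal (spanDistSq o h) =
      ⨅ c : J → ℂ, ENNReal.ofReal (‖h - ∑ j, c j • o j‖ ^ 2) := by
  have e : ‖(Submodule.span ℂ (Set.range o))ᗮ.orthogonalProjectionOnto h‖ =
      ‖h - (Submodule.span ℂ (Set.range o)).starProjection h‖ := by
    rw [Submodule.orthogonalProjectionOnto_orthogonal]
    rfl
  apply le_antisymm
  · refine le_iInf fun c => ENNReal.ofReal_le_ofReal ?_
    rw [spanDistSq, e, Submodule.starProjection_minimal]
    have hc : ∑ j, c j • o j ∈ Submodule.span ℂ (Set.range o) :=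
      Submodule.sum_mem _ fun j _ =>
        Submodule.smul_mem _ _ (Submodule.subset_span (Set.mem_range_self j))
    have : ⨅ x : Submodule.span ℂ (Set.range o), ‖h - x‖ ≤ ‖h - ∑ j, c j • o j‖ :=
      ciInf_le (f := fun x : Submodule.span ℂ (Set.range o) => ‖h - x‖)
        ⟨0, Set.forall_mem_range.mpr fun _ => norm_nonneg _⟩ ⟨_, hc⟩
    exact pow_le_pow_left₀ (Real.iInf_nonneg fun _ => norm_nonneg _) this 2
  · obtain ⟨c, hc⟩ := (Submodule.mem_span_range_iff_exists_fun ℂ).1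
      ((Submodule.span ℂ (Set.range o)).starProjection_apply_mem h)
    refine (iInf_le _ c).trans_eq ?_
    rw [spanDistSq, e, hc]

/-- The distance is discontinuous in `o` where the rank drops, but as an infimum of continuous
functions over the coefficients it is upper semicontinuous. -/
lemma measurable_spanDistSq {L : ℕ} {J : Type*} [Finite J] :
    Measurable fun x : (J → EuclideanSpace ℂ (Fin L)) × EuclideanSpace ℂ (Fin L) =>
      spanDistSq x.1 x.2 := by
  have := Fintype.ofFinite J
  have h1 : Measurable fun x : (J → EuclideanSpace ℂ (Fin L)) × EuclideanSpace ℂ (Fin L) =>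
      ENNReal.ofReal (spanDistSq x.1 x.2) := by
    simp_rw [ofReal_spanDistSq]
    refine UpperSemicontinuous.measurable (upperSemicontinuous_iInf fun c => ?_)
    exact (ENNReal.continuous_ofReal.comp (by fun_prop)).upperSemicontinuous
  convert h1.ennreal_toReal using 2 with x
  rw [ENNReal.toReal_ofReal (spanDistSq_nonneg _ _)]

/-- Needs no linear independence. This suffices for the inverse moment, from which almost sure
independence is then deduced without circularity. -/
lemma finrank_orthogonal_span_range_le {L : ℕ} {J : Type*} [Fintype J]
    (o : J → EuclideanSpace ℂ (Fin L)) :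
    L ≤ Fintype.card J + Module.finrank ℂ (Submodule.span ℂ (Set.range o))ᗮ := by
  have h := (Submodule.span ℂ (Set.range o)).finrank_add_finrank_orthogonal
  have h2 := finrank_range_le_card (R := ℂ) o
  rw [Set.finrank] at h2
  rw [finrank_euclideanSpace_fin] at h
  omega

lemma finrank_orthogonal_span_range_eq {L : ℕ} {J : Type*} [Fintype J]
    {o : J → EuclideanSpace ℂ (Fin L)} (ho : LinearIndependent ℂ o) :
    L = Fintype.card J + Module.finrank ℂ (Submodule.span ℂ (Set.range o))ᗮ := by
  have h := (Submodule.span ℂ (Set.range o)).finrank_add_finrank_orthogonal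
  rw [finrank_euclideanSpace_fin, finrank_span_eq_card ho] at h
  exact h.symm

/-- The diagonal entries of an inverse Gram matrix are the inverse squared distances of the
vectors to the span of the others. -/
lemma gram_inv_diag_eq {L : ℕ} {σ : Type*} [Fintype σ] [DecidableEq σ]
    {v : σ → EuclideanSpace ℂ (Fin L)} (hv : LinearIndependent ℂ v) (s : σ) :
    (Matrix.gram ℂ v)⁻¹ s s =
      ((spanDistSq (fun j : {j // j ≠ s} => v j) (v s))⁻¹ : ℝ) := by
  set W := Submodule.span ℂ (Set.range fun j : {j // j ≠ s} => v j) 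
  set x := Wᗮ.orthogonalProjectionOnto (v s) with hx
  have hdet : IsUnit (Matrix.gram ℂ v).det :=
    isUnit_iff_ne_zero.2 ((Matrix.det_gram_ne_zero_iff_linearIndependent.2 hv))
  obtain ⟨c, hc⟩ := (Submodule.mem_span_range_iff_exists_fun ℂ).1
    (W.starProjection_apply_mem (v s))
  -- The coefficients of the residual `x` of `v s` in the family `v`. The entries of `gram * a` are
  -- the products `⟪v i, x⟫`, which vanish for `i ≠ s`; so `a` is `‖x‖ ^ 2` times column `s` of the
  -- inverse, and `a s = 1`.
  set a : σ → ℂ := fun j => if hj : j = s then 1 else -c ⟨j, hj⟩ with ha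
  have hxa : (x : EuclideanSpace ℂ (Fin L)) = ∑ j, a j • v j := by
    rw [hx, Submodule.orthogonalProjectionOnto_orthogonal]
    simp only
    have h2 : ∑ j : {j // j ≠ s}, a j • v j = -∑ j : {j // j ≠ s}, c j • v j := by
      rw [← Finset.sum_neg_distrib]
      refine Finset.sum_congr rfl fun j _ => ?_
      simp [ha, j.2]
    rw [← hc, Fintype.sum_eq_add_sum_subtype_ne _ s, h2, sub_eq_add_neg]
    simp [ha]
  have hmul : Matrix.gram ℂ v *ᵥ a = Pi.single s ((‖x‖ ^ 2 : ℝ) : ℂ) := by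
    ext i
    have h1 : (Matrix.gram ℂ v *ᵥ a) i = inner ℂ (v i) (x : EuclideanSpace ℂ (Fin L)) := by
      rw [hxa, inner_sum]
      simp [Matrix.mulVec, dotProduct, inner_smul_right, mul_comm]
    rw [h1]
    by_cases hi : i = s
    · subst hi
      rw [← Submodule.inner_orthogonalProjectionOnto_eq_of_mem_right, ← hx,
        inner_self_eq_norm_sq_to_K]
      simp
    · rw [Pi.single_eq_of_ne hi]
      have hiW : v i ∈ W := Submodule.subset_span ⟨(⟨i, hi⟩ : {j // j ≠ s}), rfl⟩
      exact Submodule.inner_right_of_mem_orthogonal hiW x.2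
  have h3 : a = (Matrix.gram ℂ v)⁻¹ *ᵥ Pi.single s ((‖x‖ ^ 2 : ℝ) : ℂ) := by
    rw [← hmul, Matrix.mulVec_mulVec, Matrix.nonsing_inv_mul _ hdet, Matrix.one_mulVec]
  have h4 := congrFun h3 s
  rw [Matrix.mulVec_single] at h4
  simp only [ha, dif_pos, Pi.smul_apply, Matrix.col_apply, MulOpposite.smul_eq_mul_unop,
    MulOpposite.unop_op] at h4
  change _ = (((‖x‖ ^ 2)⁻¹ : ℝ) : ℂ)
  rw [Complex.ofReal_inv]
  exact eq_inv_of_mul_eq_one_left h4.symm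

/-! ### Gain moments for independent Gaussian columns. -/

variable {Ω : Type*} [MeasurableSpace Ω] {μ : Measure Ω}

lemma aemeasurable_others {σ E : Type*} [Finite σ] [MeasurableSpace E] {V : Ω → σ → E}
    (hV : ∀ s, AEMeasurable (fun ω => V ω s) μ) (s : σ) :
    AEMeasurable (fun ω (j : {j // j ≠ s}) => V ω j) μ :=
  aemeasurable_pi_lambda _ fun j => hV j

lemma lintegral_comp_prod_of_indepFun [IsProbabilityMeasure μ] {α γ : Type*}
    [MeasurableSpace α] [MeasurableSpace γ]
    {X : Ω → α} {Y : Ω → γ} (hX : AEMeasurable X μ) (hY : AEMeasurable Y μ)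
    (hXY : IndepFun X Y μ) {f : α × γ → ℝ≥0∞} (hf : Measurable f) :
    ∫⁻ ω, f (X ω, Y ω) ∂μ = ∫⁻ ω, ∫⁻ y, f (X ω, y) ∂(μ.map Y) ∂μ := by
  have h := (indepFun_iff_map_prod_eq_prod_map_map hX hY).1 hXY
  have := Measure.isProbabilityMeasure_map (μ := μ) hY
  rw [← lintegral_map' (f := f) hf.aemeasurable (hX.prodMk hY), h,
    lintegral_prod _ hf.aemeasurable, lintegral_map' _ hX]
  exact hf.lintegral_prod_right'.aemeasurable

/-- Mutually independent random vectors in `ℂ^L`, each with independent centred complex Gaussian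
coordinates. -/
structure IsGaussianColumns {σ : Type*} {L : ℕ} (μ : Measure Ω)
    (V : Ω → σ → EuclideanSpace ℂ (Fin L)) (β : σ → ℝ) : Prop where
  law : ∀ s, HasLaw (fun ω => V ω s) (complexGaussianVec L (β s)) μ
  indep : ∀ s, IndepFun (fun ω (j : {j // j ≠ s}) => V ω j) (fun ω => V ω s) μ

namespace IsGaussianColumns

variable {σ : Type*} [Fintype σ] {L : ℕ} {V : Ω → σ → EuclideanSpace ℂ (Fin L)} {β : σ → ℝ}

lemma aemeasurable_spanDistSq (hV : IsGaussianColumns μ V β) (s : σ) :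
    AEMeasurable (fun ω => spanDistSq (fun j : {j // j ≠ s} => V ω j) (V ω s)) μ := by
  have h := (aemeasurable_others (fun s => (hV.law s).aemeasurable) s).prodMk
    (hV.law s).aemeasurable
  exact Measurable.comp_aemeasurable
    (f := fun ω => ((fun j : {j // j ≠ s} => V ω j), V ω s)) measurable_spanDistSq h

variable [IsProbabilityMeasure μ]

/-- Conditionally on the `card σ - 1` other columns, the projection lives in dimension `d ≥ L - card
σ + 1 ≥ 2` and the mean is `1 / (β (d - 1))`. A rank drop only raises `d` and lowers this mean. -/
lemma lintegral_inv_spanDistSq_le (hV : IsGaussianColumns μ V β) (hβ : ∀ s, 0 < β s)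
    (hL : Fintype.card σ < L) (s : σ) :
    ∫⁻ ω, (ENNReal.ofReal (spanDistSq (fun j : {j // j ≠ s} => V ω j) (V ω s)))⁻¹ ∂μ ≤
      ENNReal.ofReal (1 / (β s * (L - Fintype.card σ))) := by
  classical
  rw [lintegral_comp_prod_of_indepFun
    (aemeasurable_others (fun s => (hV.law s).aemeasurable) s) (hV.law s).aemeasurable
    (hV.indep s) (f := fun x => (ENNReal.ofReal (spanDistSq x.1 x.2))⁻¹)
    measurable_spanDistSq.ennreal_ofReal.inv, (hV.law s).map_eq]
  have hcard : Fintype.card {j // j ≠ s} = Fintype.card σ - 1 := by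
    simp [Fintype.card_subtype_compl]
  have hpos : 0 < Fintype.card σ := Fintype.card_pos_iff.2 ⟨s⟩
  calc _ ≤ ∫⁻ _, ENNReal.ofReal (1 / (β s * (L - Fintype.card σ))) ∂μ := by
        refine lintegral_mono fun ω => ?_
        have hd := finrank_orthogonal_span_range_le (fun j : {j // j ≠ s} => V ω j)
        rw [hcard] at hd
        simp only [spanDistSq]
        rw [lintegral_inv_normSq_orthogonalProjection (hβ s) _ (by omega)]
        refine ENNReal.ofReal_le_ofReal (one_div_le_one_div_of_le ?_ ?_)
        · have : (Fintype.card σ : ℝ) < L := by exact_mod_cast hL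
          exact mul_pos (hβ s) (by linarith)
        · refine mul_le_mul_of_nonneg_left ?_ (hβ s).le
          have : (L : ℝ) + 1 ≤ Fintype.card σ + Module.finrank ℂ
              (Submodule.span ℂ (Set.range fun j : {j // j ≠ s} => V ω j))ᗮ := by
            exact_mod_cast (by omega)
          linarith
    _ = _ := by simp

/-- In `ℝ≥0∞` the inverse of `0` is `∞`, so a finite mean of the inverse excludes distance zero
almost surely. -/
lemma ae_spanDistSq_pos (hV : IsGaussianColumns μ V β) (hβ : ∀ s, 0 < β s)
    (hL : Fintype.card σ < L) :
    ∀ᵐ ω ∂μ, ∀ s, 0 < spanDistSq (fun j : {j // j ≠ s} => V ω j) (V ω s) := by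
  rw [ae_all_iff]
  intro s
  have h := ae_lt_top' (hV.aemeasurable_spanDistSq s).ennreal_ofReal.inv
    ((hV.lintegral_inv_spanDistSq_le hβ hL s).trans_lt ENNReal.ofReal_lt_top).ne
  filter_upwards [h] with ω hω
  simpa [pos_iff_ne_zero] using hω

lemma ae_linearIndependent (hV : IsGaussianColumns μ V β) (hβ : ∀ s, 0 < β s)
    (hL : Fintype.card σ < L) : ∀ᵐ ω ∂μ, LinearIndependent ℂ (V ω) := by
  filter_upwards [hV.ae_spanDistSq_pos hβ hL] with ω hω
  rw [linearIndependent_iff_notMem_span]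
  intro s hs
  refine (hω s).ne' (spanDistSq_eq_zero_of_mem ?_)
  have hr : (Set.range fun j : {j // j ≠ s} => V ω j) = V ω '' (Set.univ \ {s}) := by
    ext x
    simp
  rwa [hr]

/-- Here a rank drop would raise the mean `β d`, so the exact dimension is needed; it is available
almost surely from `ae_linearIndependent`. -/
lemma lintegral_spanDistSq_le (hV : IsGaussianColumns μ V β) (hβ : ∀ s, 0 < β s)
    (hL : Fintype.card σ < L) (s : σ) :
    ∫⁻ ω, ENNReal.ofReal (spanDistSq (fun j : {j // j ≠ s} => V ω j) (V ω s)) ∂μ ≤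
      ENNReal.ofReal (β s * (L - Fintype.card σ + 1)) := by
  classical
  rw [lintegral_comp_prod_of_indepFun
    (aemeasurable_others (fun s => (hV.law s).aemeasurable) s) (hV.law s).aemeasurable
    (hV.indep s) (f := fun x => ENNReal.ofReal (spanDistSq x.1 x.2))
    measurable_spanDistSq.ennreal_ofReal, (hV.law s).map_eq]
  have hcard : Fintype.card {j // j ≠ s} = Fintype.card σ - 1 := by
    simp [Fintype.card_subtype_compl]
  have hpos : 0 < Fintype.card σ := Fintype.card_pos_iff.2 ⟨s⟩
  calc _ ≤ ∫⁻ _, ENNReal.ofReal (β s * (L - Fintype.card σ + 1)) ∂μ := by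
        refine lintegral_mono_ae ?_
        filter_upwards [hV.ae_linearIndependent hβ hL] with ω hω
        have hd := finrank_orthogonal_span_range_eq
          (hω.comp (fun j : {j // j ≠ s} => (j : σ)) Subtype.val_injective)
        rw [hcard] at hd
        simp only [spanDistSq]
        rw [lintegral_normSq_orthogonalProjection (hβ s).le]
        refine ENNReal.ofReal_le_ofReal (mul_le_mul_of_nonneg_left ?_ (hβ s).le)
        have : (L : ℝ) + 1 = Fintype.card σ + Module.finrank ℂ
            (Submodule.span ℂ (Set.range fun j : {j // j ≠ s} => V ω j))ᗮ := by
          have hd' : L = Fintype.card σ - 1 + Module.finrank ℂ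
            (Submodule.span ℂ (Set.range fun j : {j // j ≠ s} => V ω j))ᗮ := hd
          exact_mod_cast (by omega)
        linarith
    _ = _ := by simp

end IsGaussianColumns

end VCCParams

end

noncomputable section

namespace VCCParams

open scoped ENNReal NNReal

/-! ### Expected logarithmic rates -/

section Rates

variable {Ω : Type*} [MeasurableSpace Ω] {μ : Measure Ω} {X : Ω → ℝ}

lemma integrable_log_one_add_mul (hX : Integrable X μ) (hpos : ∀ᵐ ω ∂μ, 0 < X ω) {a : ℝ}
    (ha : 0 ≤ a) : Integrable (fun ω => Real.log (1 + a * X ω)) μ := by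
  refine (hX.const_mul a).mono'
    (Real.measurable_log.comp_aemeasurable
      ((hX.aemeasurable.const_mul a).const_add 1)).aestronglyMeasurable ?_
  filter_upwards [hpos] with ω hω
  have h0 : 0 ≤ a * X ω := by positivity
  rw [Real.norm_eq_abs, abs_of_nonneg (Real.log_nonneg (by linarith))]
  linarith [Real.log_le_sub_one_of_pos (show 0 < 1 + a * X ω by linarith)]

lemma log_one_add_mul_sub_le {a b x : ℝ} (hb : 0 ≤ b) (hx : 0 < x) (hab : b ≤ a) :
    Real.log (1 + a * x) - Real.log (1 + b * x) ≤ (a - b) * x := by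
  have h1 : 0 < 1 + b * x := by positivity
  have h2 : 0 < 1 + a * x := by have := hb.trans hab; positivity
  rw [← Real.log_div h2.ne' h1.ne']
  refine (Real.log_le_sub_one_of_pos (div_pos h2 h1)).trans ?_
  rw [div_sub_one h1.ne', div_le_iff₀ h1]
  have h3 : 0 ≤ (a - b) * x := mul_nonneg (by linarith) hx.le
  nlinarith [mul_nonneg h3 (mul_nonneg hb hx.le)]

/-- The pointwise bound `log_one_add_mul_sub_le` integrates to a Lipschitz estimate with constant `𝔼
X`. -/
lemma continuousOn_integral_log_one_add_mul (hX : Integrable X μ) (hpos : ∀ᵐ ω ∂μ, 0 < X ω) :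
    ContinuousOn (fun a => ∫ ω, Real.log (1 + a * X ω) ∂μ) (Set.Ici 0) := by
  have hE : 0 ≤ ∫ ω, X ω ∂μ := integral_nonneg_of_ae (hpos.mono fun ω h => h.le)
  have key : ∀ a ∈ Set.Ici (0 : ℝ), ∀ b ∈ Set.Ici (0 : ℝ), b ≤ a →
      dist (∫ ω, Real.log (1 + a * X ω) ∂μ) (∫ ω, Real.log (1 + b * X ω) ∂μ) ≤
        (∫ ω, X ω ∂μ) * dist a b := by
    intro a ha b hb hab
    rw [Real.dist_eq, Real.dist_eq, abs_of_nonneg (sub_nonneg.2 hab), mul_comm,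
      ← integral_const_mul, ← integral_sub (integrable_log_one_add_mul hX hpos ha)
      (integrable_log_one_add_mul hX hpos hb), abs_of_nonneg]
    · refine integral_mono_ae ((integrable_log_one_add_mul hX hpos ha).sub
        (integrable_log_one_add_mul hX hpos hb)) (hX.const_mul _) ?_
      filter_upwards [hpos] with ω hω
      exact log_one_add_mul_sub_le hb hω hab
    · refine integral_nonneg_of_ae ?_
      filter_upwards [hpos] with ω hω
      have hb' : (0 : ℝ) ≤ b := hb
      exact sub_nonneg.2 (Real.log_le_log (by positivity)
        (by linarith [mul_le_mul_of_nonneg_right hab hω.le]))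
  refine (LipschitzOnWith.of_dist_le_mul (K := (∫ ω, X ω ∂μ).toNNReal)
    fun a ha b hb => ?_).continuousOn
  rw [Real.coe_toNNReal _ hE]
  rcases le_total b a with h | h
  · exact key a ha b hb h
  · rw [dist_comm, dist_comm a b]
    exact key b hb a ha h

lemma strictMonoOn_integral_log_one_add_mul [NeZero μ] (hX : Integrable X μ)
    (hpos : ∀ᵐ ω ∂μ, 0 < X ω) :
    StrictMonoOn (fun a => ∫ ω, Real.log (1 + a * X ω) ∂μ) (Set.Ici 0) := by
  intro b hb a ha hab
  have hb' : (0 : ℝ) ≤ b := hb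
  have hlt : ∀ᵐ ω ∂μ, 0 < Real.log (1 + a * X ω) - Real.log (1 + b * X ω) := by
    filter_upwards [hpos] with ω hω
    exact sub_pos.2 (Real.log_lt_log (by positivity)
      (by linarith [mul_lt_mul_of_pos_right hab hω]))
  have hi := (integrable_log_one_add_mul hX hpos ha).sub (integrable_log_one_add_mul hX hpos hb)
  have hnn := integral_nonneg_of_ae (hlt.mono fun ω h => h.le)
  have hne : ∫ ω, (Real.log (1 + a * X ω) - Real.log (1 + b * X ω)) ∂μ ≠ 0 := by
    intro h0
    have h1 := (integral_eq_zero_iff_of_nonneg_ae (hlt.mono fun ω h => h.le) hi).1 h0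
    obtain ⟨ω, h2, h3⟩ := (hlt.and h1).exists
    exact h2.ne' h3
  have h4 := lt_of_le_of_ne hnn hne.symm
  rw [integral_sub (integrable_log_one_add_mul hX hpos ha)
    (integrable_log_one_add_mul hX hpos hb)] at h4
  exact sub_pos.1 h4

/-- The tangent of `log` at `c`, from which the Jensen-type bounds below are derived. -/
lemma log_le_log_add_sub_div {x c : ℝ} (hx : 0 < x) (hc : 0 < c) :
    Real.log x ≤ Real.log c + (x - c) / c := by
  have h := Real.log_le_sub_one_of_pos (div_pos hx hc)
  rw [Real.log_div hx.ne' hc.ne', div_sub_one hc.ne'] at h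
  linarith

/-- Integrating the tangent at `1 + a c`; its slope is nonnegative, so an upper bound `c` on the
mean is enough. -/
lemma integral_log_one_add_mul_le [IsProbabilityMeasure μ] (hX : Integrable X μ)
    (hpos : ∀ᵐ ω ∂μ, 0 < X ω) {c : ℝ} (hc : 0 ≤ c) (hXc : ∫ ω, X ω ∂μ ≤ c) {a : ℝ}
    (ha : 0 ≤ a) : ∫ ω, Real.log (1 + a * X ω) ∂μ ≤ Real.log (1 + a * c) := by
  have hac : 0 < 1 + a * c := by positivity
  calc ∫ ω, Real.log (1 + a * X ω) ∂μ
      ≤ ∫ ω, (Real.log (1 + a * c) + a / (1 + a * c) * (X ω - c)) ∂μ := by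
        refine integral_mono_ae (integrable_log_one_add_mul hX hpos ha) ?_ ?_
        · exact (integrable_const _).add ((hX.sub (integrable_const _)).const_mul _)
        · filter_upwards [hpos] with ω hω
          refine (log_le_log_add_sub_div (by positivity) hac).trans_eq ?_
          ring
    _ = Real.log (1 + a * c) + a / (1 + a * c) * (∫ ω, X ω ∂μ - c) := by
        have hi : Integrable (fun ω => a / (1 + a * c) * (X ω - c)) μ :=
          (hX.sub (integrable_const _)).const_mul _
        rw [integral_add (integrable_const _) hi,
          integral_const_mul, integral_sub hX (integrable_const _)]
        simp
    _ ≤ Real.log (1 + a * c) := by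
        have : a / (1 + a * c) * (∫ ω, X ω ∂μ - c) ≤ 0 :=
          mul_nonpos_of_nonneg_of_nonpos (by positivity) (by linarith)
        linarith

/-- The function `y ↦ log (1 + a / y)` is convex, and the left side is its tangent at `c`. The proof
uses the tangent of `log` at `1 + a / y`, leaving a remainder that is a multiple of `(y - c) ^ 2`.
-/
lemma log_one_add_div_ge_tangent {a c y : ℝ} (ha : 0 ≤ a) (hc : 0 < c) (hy : 0 < y) :
    Real.log (1 + a / c) - a / (c * (c + a)) * (y - c) ≤ Real.log (1 + a / y) := by
  have h1 : 0 < 1 + a / c := by positivity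
  have h2 : 0 < 1 + a / y := by positivity
  have h := log_le_log_add_sub_div h1 h2
  have h3 : (1 + a / c - (1 + a / y)) / (1 + a / y) ≤ a / (c * (c + a)) * (y - c) := by
    have e : a / (c * (c + a)) * (y - c) - (1 + a / c - (1 + a / y)) / (1 + a / y) =
        a * (y - c) ^ 2 / (c * (c + a) * (y + a)) := by
      field_simp
      ring
    have : 0 ≤ a * (y - c) ^ 2 / (c * (c + a) * (y + a)) := by positivity
    linarith
  linarith

lemma le_integral_log_one_add_mul [IsProbabilityMeasure μ] (hX : Integrable X μ)
    (hpos : ∀ᵐ ω ∂μ, 0 < X ω) (hXi : Integrable (fun ω => (X ω)⁻¹) μ) {c : ℝ} (hc : 0 < c)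
    (hXc : ∫ ω, (X ω)⁻¹ ∂μ ≤ c) {a : ℝ} (ha : 0 ≤ a) :
    Real.log (1 + a / c) ≤ ∫ ω, Real.log (1 + a * X ω) ∂μ := by
  calc Real.log (1 + a / c)
      ≤ Real.log (1 + a / c) - a / (c * (c + a)) * (∫ ω, (X ω)⁻¹ ∂μ - c) := by
        have : a / (c * (c + a)) * (∫ ω, (X ω)⁻¹ ∂μ - c) ≤ 0 :=
          mul_nonpos_of_nonneg_of_nonpos (by positivity) (by linarith)
        linarith
    _ = ∫ ω, (Real.log (1 + a / c) - a / (c * (c + a)) * ((X ω)⁻¹ - c)) ∂μ := by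
        have hi : Integrable (fun ω => a / (c * (c + a)) * ((X ω)⁻¹ - c)) μ :=
          (hXi.sub (integrable_const _)).const_mul _
        rw [integral_sub (integrable_const _) hi,
          integral_const_mul, integral_sub hXi (integrable_const _)]
        simp
    _ ≤ ∫ ω, Real.log (1 + a * X ω) ∂μ := by
        refine integral_mono_ae ?_ (integrable_log_one_add_mul hX hpos ha) ?_
        · exact (integrable_const _).sub ((hXi.sub (integrable_const _)).const_mul _)
        · filter_upwards [hpos] with ω hω
          have := log_one_add_div_ge_tangent ha hc (inv_pos.2 hω)
          rwa [div_inv_eq_mul] at this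

lemma integrable_of_lintegral_ofReal_le {c : ℝ} (hX : AEMeasurable X μ)
    (hpos : ∀ᵐ ω ∂μ, 0 < X ω) (h : ∫⁻ ω, ENNReal.ofReal (X ω) ∂μ ≤ ENNReal.ofReal c) :
    Integrable X μ := by
  refine ⟨hX.aestronglyMeasurable, ?_⟩
  rw [hasFiniteIntegral_iff_ofReal (hpos.mono fun ω h => h.le)]
  exact h.trans_lt ENNReal.ofReal_lt_top

lemma integral_le_of_lintegral_ofReal_le {c : ℝ} (hc : 0 ≤ c) (hX : AEMeasurable X μ)
    (hpos : ∀ᵐ ω ∂μ, 0 < X ω) (h : ∫⁻ ω, ENNReal.ofReal (X ω) ∂μ ≤ ENNReal.ofReal c) :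
    ∫ ω, X ω ∂μ ≤ c := by
  rw [integral_eq_lintegral_of_nonneg_ae (hpos.mono fun ω h => h.le) hX.aestronglyMeasurable]
  exact ENNReal.toReal_le_of_le_ofReal hc h

end Rates

/-! ### The zero-forcing gains -/

variable {Ψ : Type*} (p : VCCParams Ψ)

/-- The channel vector of a stream. -/
def streamVec (h : p.Channel) (ψ : Ψ) (s : p.Stream ψ) : EuclideanSpace ℂ (Fin p.L) :=
  WithLp.toLp 2 fun i => h ψ s.1 i s.2

/-- The zero-forcing channel gain of a stream: the squared distance of its channel vector to the
span of the other channel vectors in the group. -/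
def zfGain (h : p.Channel) (ψ : Ψ) (s : p.Stream ψ) : ℝ :=
  spanDistSq (fun j : {j // j ≠ s} => p.streamVec h ψ j) (p.streamVec h ψ s)

lemma zfGain_nonneg (h : p.Channel) (ψ : Ψ) (s : p.Stream ψ) : 0 ≤ p.zfGain h ψ s :=
  spanDistSq_nonneg _ _

/-- The transpose appears because the inner product is conjugate-linear in its first argument. -/
lemma gram_streamVec (h : p.Channel) (ψ : Ψ) :
    (p.groupChannel h ψ)ᵀ * (p.groupChannel h ψ).map star =
      (Matrix.gram ℂ (p.streamVec h ψ))ᵀ := by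
  ext i j
  simp [Matrix.mul_apply, groupChannel, streamVec, PiLp.inner_apply]

lemma gramInv_diag {h : p.Channel} {ψ : Ψ} (hli : LinearIndependent ℂ (p.streamVec h ψ))
    (s : p.Stream ψ) : p.gramInv h ψ s s = ((p.zfGain h ψ s)⁻¹ : ℝ) := by
  rw [gramInv, gram_streamVec, ← Matrix.transpose_nonsing_inv, Matrix.transpose_apply,
    gram_inv_diag_eq hli, zfGain]

/-- The Gram matrix cancels against its inverse, leaving only the column normalization: no
interference, and a diagonal entry whose square is `zfGain`. -/
lemma effChannel_apply {h : p.Channel} {ψ : Ψ} (hli : LinearIndependent ℂ (p.streamVec h ψ))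
    (s s' : p.Stream ψ) :
    p.effChannel h ψ s s' =
      if s = s' then (((Real.sqrt (p.zfGain h ψ s')⁻¹)⁻¹ : ℝ) : ℂ) else 0 := by
  have hdet : IsUnit ((p.groupChannel h ψ)ᵀ * (p.groupChannel h ψ).map star).det := by
    rw [gram_streamVec, Matrix.det_transpose]
    exact isUnit_iff_ne_zero.2 (Matrix.det_gram_ne_zero_iff_linearIndependent.2 hli)
  have h1 : p.effChannel h ψ s s' =
      ((p.groupChannel h ψ)ᵀ * ((p.groupChannel h ψ).map star * p.gramInv h ψ)) s s' *
        (((Real.sqrt (p.gramInv h ψ s' s').re)⁻¹ : ℝ) : ℂ) := by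
    rw [effChannel, Matrix.mul_apply, Matrix.mul_apply, Finset.sum_mul]
    refine Finset.sum_congr rfl fun i _ => ?_
    simp only [zfPrecoder, Matrix.hadamard_apply, zfNormalization, Matrix.of_apply]
    ring
  rw [h1, ← Matrix.mul_assoc, gramInv, Matrix.mul_nonsing_inv _ hdet, ← gramInv,
    p.gramInv_diag hli, Complex.ofReal_re, Matrix.one_apply]
  split_ifs <;> simp

lemma sinr_eq (P : p.Power) {h : p.Channel} {ψ : Ψ}
    (hli : LinearIndependent ℂ (p.streamVec h ψ)) (s : p.Stream ψ) :
    p.sinr P h ψ s = P ψ s.1 s.2 / p.N₀ * p.zfGain h ψ s := by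
  have h0 : ∑ s' ∈ Finset.univ.erase s,
      P ψ s'.1 s'.2 * ‖p.effChannel h ψ s s'‖ ^ 2 = 0 := by
    refine Finset.sum_eq_zero fun s' hs' => ?_
    rw [p.effChannel_apply hli, if_neg (Finset.ne_of_mem_erase hs').symm]
    simp
  rw [sinr, h0, p.effChannel_apply hli, if_pos rfl, Complex.norm_real, Real.norm_eq_abs, sq_abs,
    inv_pow, Real.sq_sqrt (inv_nonneg.2 (p.zfGain_nonneg h ψ s)), inv_inv]
  ring

/-! ### Mean stream and user rates under Rayleigh fading. -/

variable {p} {Ω : Type*} [MeasurableSpace Ω] {μ : Measure Ω} {H : Ω → p.Channel}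

/-- The fading-averaged rate (without the CSI factor) of a stream sent with power `x`. -/
def streamRate (μ : Measure Ω) (H : Ω → p.Channel) (ψ : Ψ) (s : p.Stream ψ) (x : ℝ) : ℝ :=
  ∫ ω, Real.log (1 + x / p.N₀ * p.zfGain (H ω) ψ s) ∂μ

@[simp]
lemma streamRate_zero (ψ : Ψ) (s : p.Stream ψ) : streamRate μ H ψ s 0 = 0 := by
  simp [streamRate]

variable [IsProbabilityMeasure μ]

lemma IsRayleigh.isGaussianColumns (hH : p.IsRayleigh μ H) (ψ : Ψ) :
    IsGaussianColumns μ (fun ω => p.streamVec (H ω) ψ) (fun s => p.β ψ s.1) where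
  law s := by
    have hm : ∀ i, AEMeasurable (fun ω => H ω ψ s.1 i s.2) μ := fun i =>
      (hH.law ψ s.1 i s.2).aemeasurable
    have hinj : Function.Injective (fun i : Fin p.L =>
        (⟨ψ, s.1, i, s.2⟩ : (ψ : Ψ) × (k : Fin p.Q) × Fin p.L × Fin (p.M ψ k))) := by
      intro i j hij
      simpa using hij
    have h := (iIndepFun_iff_map_fun_eq_pi_map hm).1 (hH.indep.precomp hinj)
    have hv : AEMeasurable (fun ω i => H ω ψ s.1 i s.2) μ := aemeasurable_pi_lambda _ hm
    refine ⟨(by fun_prop : Measurable (WithLp.toLp 2 : (Fin p.L → ℂ) → _)).comp_aemeasurable hv,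
      ?_⟩
    change μ.map (WithLp.toLp 2 ∘ fun ω i => H ω ψ s.1 i s.2) = _
    rw [← AEMeasurable.map_map_of_aemeasurable (by fun_prop) hv, h, complexGaussianVec]
    congr 2
    funext i
    exact (hH.law ψ s.1 i s.2).map_eq
  indep s := by
    have hinj : Function.Injective (fun x : p.Stream ψ × Fin p.L =>
        (⟨ψ, x.1.1, x.2, x.1.2⟩ : (ψ : Ψ) × (k : Fin p.Q) × Fin p.L × Fin (p.M ψ k))) := by
      rintro ⟨⟨k, q⟩, i⟩ ⟨⟨k', q'⟩, i'⟩ hij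
      simp only [Sigma.mk.injEq, heq_eq_eq, true_and] at hij
      obtain ⟨rfl, hij⟩ := hij
      simp only [heq_eq_eq, Prod.mk.injEq] at hij
      obtain ⟨rfl, rfl⟩ := hij
      rfl
    -- The entries of column `s` and those of the other columns form disjoint blocks of an
    -- independent family.
    have h := (hH.indep.precomp hinj).indepFun_finset₀
      (Finset.univ.filter fun x => x.1 ≠ s) (Finset.univ.filter fun x => x.1 = s)
      (by
        rw [Finset.disjoint_left]
        intro x hx hx'
        exact (Finset.mem_filter.1 hx).2 (Finset.mem_filter.1 hx').2)
      (fun x => (hH.law ψ x.1.1 x.2 x.1.2).aemeasurable)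
    refine h.comp (φ := fun f (j : {j // j ≠ s}) => WithLp.toLp 2 fun i =>
        f ⟨(j, i), Finset.mem_filter.2 ⟨Finset.mem_univ _, j.2⟩⟩)
      (ψ := fun f => WithLp.toLp 2 fun i =>
        f ⟨(s, i), Finset.mem_filter.2 ⟨Finset.mem_univ _, rfl⟩⟩) ?_ ?_
    · refine measurable_pi_lambda _ fun j => ?_
      fun_prop
    · fun_prop

lemma card_stream (ψ : Ψ) : Fintype.card (p.Stream ψ) = p.Mgrp ψ := by
  simp [Mgrp, Fintype.card_sigma]

lemma IsRayleigh.aemeasurable_zfGain (hH : p.IsRayleigh μ H) (ψ : Ψ) (s : p.Stream ψ) :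
    AEMeasurable (fun ω => p.zfGain (H ω) ψ s) μ :=
  (hH.isGaussianColumns ψ).aemeasurable_spanDistSq s

lemma IsRayleigh.ae_zfGain_pos (hH : p.IsRayleigh μ H) (hβ : ∀ ψ k, 0 < p.β ψ k) {ψ : Ψ}
    (hL : p.Mgrp ψ < p.L) (s : p.Stream ψ) : ∀ᵐ ω ∂μ, 0 < p.zfGain (H ω) ψ s :=
  ((hH.isGaussianColumns ψ).ae_spanDistSq_pos (fun _ => hβ _ _)
    (by rw [card_stream]; exact hL)).mono fun _ h => h s

lemma IsRayleigh.lintegral_zfGain_le (hH : p.IsRayleigh μ H) (hβ : ∀ ψ k, 0 < p.β ψ k) {ψ : Ψ}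
    (hL : p.Mgrp ψ < p.L) (s : p.Stream ψ) :
    ∫⁻ ω, ENNReal.ofReal (p.zfGain (H ω) ψ s) ∂μ ≤
      ENNReal.ofReal (p.β ψ s.1 * (p.L - p.Mgrp ψ + 1)) := by
  have h := (hH.isGaussianColumns ψ).lintegral_spanDistSq_le (fun _ => hβ _ _)
    (by rw [card_stream]; exact hL) s
  rwa [card_stream] at h

lemma IsRayleigh.lintegral_inv_zfGain_le (hH : p.IsRayleigh μ H) (hβ : ∀ ψ k, 0 < p.β ψ k)
    {ψ : Ψ} (hL : p.Mgrp ψ < p.L) (s : p.Stream ψ) :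
    ∫⁻ ω, ENNReal.ofReal (p.zfGain (H ω) ψ s)⁻¹ ∂μ ≤
      ENNReal.ofReal (1 / (p.β ψ s.1 * (p.L - p.Mgrp ψ))) := by
  have h := (hH.isGaussianColumns ψ).lintegral_inv_spanDistSq_le (fun _ => hβ _ _)
    (by rw [card_stream]; exact hL) s
  rw [card_stream] at h
  refine le_trans (le_of_eq (lintegral_congr_ae ?_)) h
  filter_upwards [hH.ae_zfGain_pos hβ hL s] with ω hω
  exact ENNReal.ofReal_inv_of_pos hω

lemma IsRayleigh.integrable_zfGain (hH : p.IsRayleigh μ H) (hβ : ∀ ψ k, 0 < p.β ψ k)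
    {ψ : Ψ} (hL : p.Mgrp ψ < p.L) (s : p.Stream ψ) :
    Integrable (fun ω => p.zfGain (H ω) ψ s) μ :=
  integrable_of_lintegral_ofReal_le (hH.aemeasurable_zfGain ψ s) (hH.ae_zfGain_pos hβ hL s)
    (hH.lintegral_zfGain_le hβ hL s)

lemma IsRayleigh.continuousOn_streamRate (hH : p.IsRayleigh μ H) (hβ : ∀ ψ k, 0 < p.β ψ k)
    (hN : 0 < p.N₀) {ψ : Ψ} (hL : p.Mgrp ψ < p.L) (s : p.Stream ψ) :
    ContinuousOn (streamRate μ H ψ s) (Set.Ici 0) :=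
  (continuousOn_integral_log_one_add_mul (hH.integrable_zfGain hβ hL s)
    (hH.ae_zfGain_pos hβ hL s)).comp (f := fun x : ℝ => x / p.N₀)
    (continuous_id.div_const _).continuousOn
    fun _ hx => div_nonneg hx hN.le

lemma IsRayleigh.strictMonoOn_streamRate (hH : p.IsRayleigh μ H) (hβ : ∀ ψ k, 0 < p.β ψ k)
    (hN : 0 < p.N₀) {ψ : Ψ} (hL : p.Mgrp ψ < p.L) (s : p.Stream ψ) :
    StrictMonoOn (streamRate μ H ψ s) (Set.Ici 0) :=
  (strictMonoOn_integral_log_one_add_mul (hH.integrable_zfGain hβ hL s)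
    (hH.ae_zfGain_pos hβ hL s)).comp (f := fun x : ℝ => x / p.N₀)
    (fun _ _ _ _ h => div_lt_div_of_pos_right h hN)
    fun _ hx => div_nonneg hx hN.le

lemma IsRayleigh.streamRate_le (hH : p.IsRayleigh μ H) (hβ : ∀ ψ k, 0 < p.β ψ k)
    (hN : 0 < p.N₀) {ψ : Ψ} (hL : p.Mgrp ψ < p.L) (s : p.Stream ψ) {x : ℝ} (hx : 0 ≤ x) :
    streamRate μ H ψ s x ≤
      Real.log (1 + x / p.N₀ * (p.β ψ s.1 * (p.L - p.Mgrp ψ + 1))) := by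
  have hL' : (p.Mgrp ψ : ℝ) < p.L := by exact_mod_cast hL
  have hc : 0 ≤ p.β ψ s.1 * (p.L - p.Mgrp ψ + 1) := mul_nonneg (hβ _ _).le (by linarith)
  exact integral_log_one_add_mul_le (hH.integrable_zfGain hβ hL s) (hH.ae_zfGain_pos hβ hL s) hc
    (integral_le_of_lintegral_ofReal_le hc (hH.aemeasurable_zfGain ψ s)
      (hH.ae_zfGain_pos hβ hL s) (hH.lintegral_zfGain_le hβ hL s)) (div_nonneg hx hN.le)

lemma IsRayleigh.le_streamRate (hH : p.IsRayleigh μ H) (hβ : ∀ ψ k, 0 < p.β ψ k)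
    (hN : 0 < p.N₀) {ψ : Ψ} (hL : p.Mgrp ψ < p.L) (s : p.Stream ψ) {x : ℝ} (hx : 0 ≤ x) :
    Real.log (1 + x / p.N₀ * (p.β ψ s.1 * (p.L - p.Mgrp ψ))) ≤ streamRate μ H ψ s x := by
  have hL' : (p.Mgrp ψ : ℝ) < p.L := by exact_mod_cast hL
  have hc : 0 < 1 / (p.β ψ s.1 * (p.L - p.Mgrp ψ)) :=
    one_div_pos.2 (mul_pos (hβ _ _) (by linarith))
  have hpos : ∀ᵐ ω ∂μ, 0 < (p.zfGain (H ω) ψ s)⁻¹ :=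
    (hH.ae_zfGain_pos hβ hL s).mono fun _ h => inv_pos.2 h
  have hm := (hH.aemeasurable_zfGain ψ s).inv
  have h := le_integral_log_one_add_mul (hH.integrable_zfGain hβ hL s)
    (hH.ae_zfGain_pos hβ hL s)
    (integrable_of_lintegral_ofReal_le hm hpos (hH.lintegral_inv_zfGain_le hβ hL s)) hc
    (integral_le_of_lintegral_ofReal_le hc.le hm hpos (hH.lintegral_inv_zfGain_le hβ hL s))
    (div_nonneg hx hN.le)
  rwa [div_div_eq_mul_div, div_one] at h

section UserRate

variable [Fintype Ψ]

lemma IsRayleigh.userRate_ae_eq (hH : p.IsRayleigh μ H) (hβ : ∀ ψ k, 0 < p.β ψ k) (P : p.Power)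
    {ψ : Ψ} (hL : p.Mgrp ψ < p.L) (k : Fin p.Q) :
    (fun ω => p.userRate P (H ω) ψ k) =ᵐ[μ] fun ω =>
      p.ξ * ∑ q, Real.log (1 + P ψ k q / p.N₀ * p.zfGain (H ω) ψ ⟨k, q⟩) := by
  filter_upwards [(hH.isGaussianColumns ψ).ae_linearIndependent (fun _ => hβ _ _)
    (by rw [card_stream]; exact hL)] with ω hω
  simp only [userRate, p.sinr_eq P hω]

lemma IsRayleigh.integrable_userRate (hH : p.IsRayleigh μ H) (hβ : ∀ ψ k, 0 < p.β ψ k)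
    (hN : 0 < p.N₀) {P : p.Power} (hP : ∀ ψ k q, 0 ≤ P ψ k q) {ψ : Ψ} (hL : p.Mgrp ψ < p.L)
    (k : Fin p.Q) : Integrable (fun ω => p.userRate P (H ω) ψ k) μ := by
  rw [integrable_congr (hH.userRate_ae_eq hβ P hL k)]
  exact (integrable_finsetSum _ fun q _ =>
    integrable_log_one_add_mul (hH.integrable_zfGain hβ hL _) (hH.ae_zfGain_pos hβ hL _)
      (div_nonneg (hP _ _ _) hN.le)).const_mul _

lemma IsRayleigh.avgUserRate_eq (hH : p.IsRayleigh μ H) (hβ : ∀ ψ k, 0 < p.β ψ k)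
    (hN : 0 < p.N₀) {P : p.Power} (hP : ∀ ψ k q, 0 ≤ P ψ k q) {ψ : Ψ} (hL : p.Mgrp ψ < p.L)
    (k : Fin p.Q) :
    p.avgUserRate μ H P ψ k = p.ξ * ∑ q, streamRate μ H ψ ⟨k, q⟩ (P ψ k q) := by
  rw [avgUserRate, integral_congr_ae (hH.userRate_ae_eq hβ P hL k), integral_const_mul,
    integral_finsetSum _ fun q _ =>
      integrable_log_one_add_mul (hH.integrable_zfGain hβ hL _) (hH.ae_zfGain_pos hβ hL _)
        (div_nonneg (hP _ _ _) hN.le)]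
  rfl

end UserRate

end VCCParams

end

noncomputable section

namespace VCCParams

/-! ### Max-min fair allocations -/

section MaxMin

variable {ι : Type*} [Fintype ι] {κ : ι → Type*} [∀ u, Fintype (κ u)]

lemma isCompact_allocations (B : ℝ) :
    IsCompact {P : ∀ u, κ u → ℝ | (∀ u q, 0 ≤ P u q) ∧ ∑ u, ∑ q, P u q ≤ B} := by
  refine (isCompact_Icc (a := (0 : ∀ u, κ u → ℝ)) (b := fun _ _ => B)).of_isClosed_subset ?_ ?_
  · have hB : IsClosed {P : ∀ u, κ u → ℝ | ∑ u, ∑ q, P u q ≤ B} :=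
      isClosed_le (by fun_prop) continuous_const
    have h0 : IsClosed {P : ∀ u, κ u → ℝ | ∀ u q, 0 ≤ P u q} := by
      simp only [Set.ofPred_forall]
      exact isClosed_iInter fun u => isClosed_iInter fun q =>
        isClosed_le continuous_const (by fun_prop)
    exact h0.inter hB
  · rintro P ⟨h0, hB⟩
    refine ⟨fun u q => h0 u q, fun u q => le_trans ?_ hB⟩
    exact (Finset.single_le_sum (fun q _ => h0 u q) (Finset.mem_univ q)).trans
      (Finset.single_le_sum (f := fun u => ∑ q, P u q)
        (fun u _ => Finset.sum_nonneg fun q _ => h0 u q) (Finset.mem_univ u))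

variable {g : ∀ u, κ u → ℝ → ℝ}

lemma exists_maxMin_allocation [Nonempty ι] (hg : ∀ u q, ContinuousOn (g u q) (Set.Ici 0))
    {B : ℝ} (hB : 0 ≤ B) :
    ∃ P : ∀ u, κ u → ℝ, ((∀ u q, 0 ≤ P u q) ∧ ∑ u, ∑ q, P u q ≤ B) ∧
      ∀ P' : ∀ u, κ u → ℝ, ((∀ u q, 0 ≤ P' u q) ∧ ∑ u, ∑ q, P' u q ≤ B) →
        ⨅ u, ∑ q, g u q (P' u q) ≤ ⨅ u, ∑ q, g u q (P u q) := by
  have hcont : ContinuousOn (fun P : ∀ u, κ u → ℝ => ⨅ u, ∑ q, g u q (P u q))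
      {P : ∀ u, κ u → ℝ | (∀ u q, 0 ≤ P u q) ∧ ∑ u, ∑ q, P u q ≤ B} := by
    simp_rw [← Finset.inf'_univ_eq_ciInf]
    refine ContinuousOn.finset_inf'_apply _ fun u _ => continuousOn_finsetSum _ fun q _ => ?_
    exact (hg u q).comp (f := fun P : ∀ u, κ u → ℝ => P u q) (by fun_prop) fun P hP => hP.1 u q
  obtain ⟨P, hP, hmax⟩ := (isCompact_allocations B).exists_isMaxOn
    ⟨0, by simpa using hB⟩ hcont
  exact ⟨P, hP, fun P' hP' => hmax hP'⟩

/-- All users have the same rate at a max-min fair allocation: otherwise power could be moved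
from a user whose rate is above the minimum to all the others. -/
lemma eq_iInf_of_maxMin [Nonempty ι] [∀ u, Nonempty (κ u)]
    (hg : ∀ u q, ContinuousOn (g u q) (Set.Ici 0))
    (hmono : ∀ u q, StrictMonoOn (g u q) (Set.Ici 0)) (hg0 : ∀ u q, g u q 0 = 0)
    {B : ℝ} {P : ∀ u, κ u → ℝ} (hP0 : ∀ u q, 0 ≤ P u q) (hPB : ∑ u, ∑ q, P u q ≤ B)
    (hmax : ∀ P' : ∀ u, κ u → ℝ, ((∀ u q, 0 ≤ P' u q) ∧ ∑ u, ∑ q, P' u q ≤ B) →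
      ⨅ u, ∑ q, g u q (P' u q) ≤ ⨅ u, ∑ q, g u q (P u q)) (u : ι) :
    ∑ q, g u q (P u q) = ⨅ u, ∑ q, g u q (P u q) := by
  classical
  set m := ⨅ u, ∑ q, g u q (P u q) with hm
  have hbdd : BddBelow (Set.range fun u => ∑ q, g u q (P u q)) := (Set.finite_range _).bddBelow
  have hmle : ∀ v, m ≤ ∑ q, g v q (P v q) := fun v => ciInf_le hbdd v
  by_contra hne
  have hlt : m < ∑ q, g u q (P u q) := lt_of_le_of_ne (hmle u) (Ne.symm hne)
  have hgnn : ∀ v q x, 0 ≤ x → 0 ≤ g v q x := fun v q x hx => by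
    rw [← hg0 v q]
    exact (hmono v q).monotoneOn Set.self_mem_Ici hx hx
  have hm0 : 0 ≤ m := le_ciInf fun v => Finset.sum_nonneg fun q _ => hgnn v q _ (hP0 v q)
  -- User `u` has power to give away: with `S = 0` its rate would be `0`, not above `m ≥ 0`.
  set S := ∑ q, P u q with hS
  have hS0 : 0 < S := by
    refine lt_of_le_of_ne (Finset.sum_nonneg fun q _ => hP0 u q) fun h => ?_
    have hz : ∀ q, P u q = 0 := fun q =>
      (Finset.sum_eq_zero_iff_of_nonneg fun q _ => hP0 u q).1 h.symm q (Finset.mem_univ q)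
    simp only [hz, hg0, Finset.sum_const_zero] at hlt
    exact absurd hlt hm0.not_gt
  set N : ℝ := ∑ v, (Fintype.card (κ v) : ℝ) with hN
  have hN0 : 0 < N := Finset.sum_pos (fun v _ => by exact_mod_cast Fintype.card_pos)
    Finset.univ_nonempty
  -- By continuity, `u` can lose a small fraction `ε` of its power and stay above `m`.
  have hpath : ContinuousWithinAt (fun ε : ℝ => ∑ q, g u q ((1 - ε) * P u q)) (Set.Icc 0 1) 0 := by
    refine (continuousOn_finsetSum _ fun q _ => ?_) 0 (by simp)
    exact (hg u q).comp (f := fun ε : ℝ => (1 - ε) * P u q) (by fun_prop)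
      fun ε hε => mul_nonneg (by linarith [hε.2]) (hP0 u q)
  have hev : ∀ᶠ ε in nhdsWithin (0 : ℝ) (Set.Icc 0 1), m < ∑ q, g u q ((1 - ε) * P u q) :=
    hpath.eventually (lt_mem_nhds (by simpa using hlt))
  have hev' : ∀ᶠ ε in nhdsWithin (0 : ℝ) (Set.Ioo 0 1), m < ∑ q, g u q ((1 - ε) * P u q) :=
    hev.filter_mono (nhdsWithin_mono _ Set.Ioo_subset_Icc_self)
  have hnb : (nhdsWithin (0 : ℝ) (Set.Ioo 0 1)).NeBot := left_nhdsWithin_Ioo_neBot one_pos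
  obtain ⟨ε, hε, hε01⟩ := (hev'.and self_mem_nhdsWithin).exists
  -- The freed power `ε S` is divided by the number `N` of all streams, including those of `u`, so
  -- the budget is respected with room to spare.
  set P' : ∀ v, κ v → ℝ := fun v q => if v = u then (1 - ε) * P v q else P v q + ε * S / N
    with hP'
  have hδ : 0 < ε * S / N := div_pos (mul_pos hε01.1 hS0) hN0
  have hP'0 : ∀ v q, 0 ≤ P' v q := by
    intro v q
    simp only [hP']
    split_ifs
    · exact mul_nonneg (by linarith [hε01.2]) (hP0 v q)
    · exact add_nonneg (hP0 v q) hδ.le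
  have hP'B : ∑ v, ∑ q, P' v q ≤ B := by
    have h1 : ∀ v, ∑ q, P' v q ≤ ∑ q, P v q + Fintype.card (κ v) * (ε * S / N) -
        if v = u then ε * S else 0 := by
      intro v
      by_cases hv : v = u
      · subst hv
        simp only [hP', if_true, ← Finset.mul_sum, ← hS]
        have : 0 ≤ (Fintype.card (κ v) : ℝ) * (ε * S / N) := by positivity
        linarith
      · simp only [hP', if_neg hv, Finset.sum_add_distrib, Finset.sum_const, Finset.card_univ,
          nsmul_eq_mul, sub_zero, le_refl]
    refine (Finset.sum_le_sum fun v _ => h1 v).trans ?_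
    rw [Finset.sum_sub_distrib, Finset.sum_add_distrib, ← Finset.sum_mul, ← hN,
      Finset.sum_ite_eq' Finset.univ u, if_pos (Finset.mem_univ u), mul_div_cancel₀ _ hN0.ne']
    linarith
  -- The new minimum is attained at some `w`, and it exceeds `m` whether `w = u` (choice of `ε`) or
  -- not (strict monotonicity), against optimality.
  obtain ⟨w, hw⟩ := exists_eq_ciInf_of_finite (f := fun v => ∑ q, g v q (P' v q))
  have hcontra := hmax P' ⟨hP'0, hP'B⟩
  rw [← hw] at hcontra
  refine absurd hcontra (not_le.2 ?_)
  by_cases hwu : w = u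
  · subst hwu
    simpa [hP'] using hε
  · refine (hmle w).trans_lt (Finset.sum_lt_sum_of_nonempty Finset.univ_nonempty fun q _ => ?_)
    refine hmono w q (hP0 w q) (hP'0 w q) ?_
    simp only [hP', if_neg hwu]
    linarith

end MaxMin

/-- Spreading the power evenly maximizes a sum of logarithmic rates with equal gains. -/
lemma sum_log_one_add_mul_le {n : ℕ} (hn : 0 < n) {a : ℝ} (ha : 0 ≤ a) {x : Fin n → ℝ}
    (hx : ∀ q, 0 ≤ x q) :
    ∑ q, Real.log (1 + x q * a) ≤ n * Real.log (1 + (∑ q, x q) * a / n) := by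
  have hS : 0 ≤ ∑ q, x q := Finset.sum_nonneg fun q _ => hx q
  have hn' : (0 : ℝ) < n := by exact_mod_cast hn
  -- The mean of the arguments: the linear terms of the tangents at `c` sum to zero.
  set c := 1 + (∑ q, x q) * a / n with hc
  have hc0 : 0 < c := by positivity
  calc ∑ q, Real.log (1 + x q * a) ≤ ∑ q, (Real.log c + (1 + x q * a - c) / c) :=
        Finset.sum_le_sum fun q _ =>
          log_le_log_add_sub_div (by have := hx q; positivity) hc0
    _ = n * Real.log c := by
        rw [Finset.sum_add_distrib, ← Finset.sum_div, Finset.sum_sub_distrib,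
          Finset.sum_add_distrib, ← Finset.sum_mul]
        simp only [Finset.sum_const, Finset.card_univ, Fintype.card_fin, nsmul_eq_mul, mul_one]
        have : (n : ℝ) + (∑ q, x q) * a - n * c = 0 := by
          rw [hc]
          field_simp
          ring
        rw [this]
        simp

/-- A positive combination of functions `exp (R / d) - 1` takes every positive value once. -/
lemma exists_root_sum_exp {ι : Type*} [Fintype ι] [Nonempty ι] {c d : ι → ℝ}
    (hc : ∀ u, 0 < c u) (hd : ∀ u, 0 < d u) {B : ℝ} (hB : 0 < B) :
    StrictMono (fun R => ∑ u, c u * (Real.exp (R / d u) - 1)) ∧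
      ∃ R, 0 < R ∧ ∑ u, c u * (Real.exp (R / d u) - 1) = B := by
  have hmono : StrictMono (fun R => ∑ u, c u * (Real.exp (R / d u) - 1)) := by
    intro x y hxy
    refine Finset.sum_lt_sum_of_nonempty Finset.univ_nonempty fun u _ => ?_
    refine mul_lt_mul_of_pos_left (sub_lt_sub_right (Real.exp_lt_exp.2 ?_) _) (hc u)
    exact div_lt_div_of_pos_right hxy (hd u)
  refine ⟨hmono, ?_⟩
  have hcont : Continuous (fun R => ∑ u, c u * (Real.exp (R / d u) - 1)) := by fun_prop
  obtain ⟨u₀⟩ := ‹Nonempty ι›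
  -- The right endpoint for the intermediate value theorem: by `exp x - 1 ≥ x`, the single term `u₀`
  -- already reaches `B` there.
  have hb : 0 ≤ B * d u₀ / c u₀ :=
    div_nonneg (mul_nonneg hB.le (hd u₀).le) (hc u₀).le
  have hbig : B ≤ ∑ u, c u * (Real.exp ((B * d u₀ / c u₀) / d u) - 1) := by
    have h1 : B ≤ c u₀ * (Real.exp ((B * d u₀ / c u₀) / d u₀) - 1) := by
      have h2 := Real.add_one_le_exp ((B * d u₀ / c u₀) / d u₀)
      have h3 : c u₀ * ((B * d u₀ / c u₀) / d u₀) = B := by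
        have := (hc u₀).ne'
        have := (hd u₀).ne'
        field_simp
      calc B = c u₀ * ((B * d u₀ / c u₀) / d u₀) := h3.symm
        _ ≤ _ := mul_le_mul_of_nonneg_left (by linarith) (hc u₀).le
    refine h1.trans (Finset.single_le_sum
      (f := fun u => c u * (Real.exp ((B * d u₀ / c u₀) / d u) - 1)) (fun u _ => ?_)
      (Finset.mem_univ u₀))
    refine mul_nonneg (hc u).le ?_
    linarith [Real.add_one_le_exp ((B * d u₀ / c u₀) / d u), div_nonneg hb (hd u).le]
  obtain ⟨R, hR, hRB⟩ := intermediate_value_Icc hb hcont.continuousOn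
    (show B ∈ Set.Icc _ _ from ⟨by simpa using hB.le, hbig⟩)
  refine ⟨R, lt_of_le_of_ne hR.1 fun h => ?_, hRB⟩
  rw [← h] at hRB
  simp only [zero_div, Real.exp_zero, sub_self, mul_zero, Finset.sum_const_zero] at hRB
  exact hB.ne hRB

end VCCParams

end

/-! ### Required power and the two bounds on the sum-rate. -/

noncomputable section

namespace VCCParams

variable {Ψ : Type*} [Fintype Ψ] {p : VCCParams Ψ}

/-- The total power needed to give every user the rate `R / (G Q)`, if the streams of group `ψ`
had the deterministic gains `β_{ψ,k} ℓ_ψ`. -/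
def requiredPower (p : VCCParams Ψ) (ℓ : Ψ → ℝ) (R : ℝ) : ℝ :=
  ∑ ψ, ∑ k, p.N₀ * p.M ψ k * (Real.exp (R / (p.ξ * G (Ψ := Ψ) * p.Q * p.M ψ k)) - 1) /
    (p.β ψ k * ℓ ψ)

lemma requiredPower_root [Nonempty Ψ] (hQ : 0 < p.Q) (hM : ∀ ψ k, 0 < p.M ψ k)
    (hβ : ∀ ψ k, 0 < p.β ψ k) (hN : 0 < p.N₀) (hP : 0 < p.Ptot) (hξ : 0 < p.ξ) {ℓ : Ψ → ℝ}
    (hℓ : ∀ ψ, 0 < ℓ ψ) :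
    StrictMono (p.requiredPower ℓ) ∧ ∃ R, 0 < R ∧ p.requiredPower ℓ R = p.Ptot := by
  have : Nonempty (Fin p.Q) := ⟨⟨0, hQ⟩⟩
  have hG : 0 < G (Ψ := Ψ) := Fintype.card_pos
  have h := exists_root_sum_exp (ι := Ψ × Fin p.Q)
    (c := fun u => p.N₀ * p.M u.1 u.2 / (p.β u.1 u.2 * ℓ u.1))
    (d := fun u => p.ξ * G (Ψ := Ψ) * p.Q * p.M u.1 u.2)
    (fun u => by have := hM u.1 u.2; have := hβ u.1 u.2; have := hℓ u.1; positivity)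
    (fun u => by have := hM u.1 u.2; positivity) hP
  have e : p.requiredPower ℓ = fun R => ∑ u : Ψ × Fin p.Q,
      p.N₀ * p.M u.1 u.2 / (p.β u.1 u.2 * ℓ u.1) *
        (Real.exp (R / (p.ξ * G (Ψ := Ψ) * p.Q * p.M u.1 u.2)) - 1) := by
    funext R
    rw [Fintype.sum_prod_type]
    exact Finset.sum_congr rfl fun ψ _ => Finset.sum_congr rfl fun k _ => by ring
  rw [e]
  exact h

lemma requiredPower_closed_form [Nonempty Ψ] (hQ : 0 < p.Q) (hβ : ∀ ψ k, 0 < p.β ψ k)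
    (hN : 0 < p.N₀) (hP : 0 < p.Ptot) (hξ : 0 < p.ξ) {M : ℕ} (hM0 : 0 < M)
    (hM : ∀ ψ k, p.M ψ k = M) {l : ℝ} (hl : 0 < l) :
    p.requiredPower (fun _ => l) (p.ξ * G (Ψ := Ψ) * p.Q * M *
      Real.log (1 + p.Ptot * l / (M * p.N₀ * ∑ ψ, ∑ k, (p.β ψ k)⁻¹))) = p.Ptot := by
  have : Nonempty (Fin p.Q) := ⟨⟨0, hQ⟩⟩
  have hG : 0 < G (Ψ := Ψ) := Fintype.card_pos
  have hS : 0 < ∑ ψ, ∑ k, (p.β ψ k)⁻¹ :=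
    Finset.sum_pos (fun ψ _ => Finset.sum_pos (fun k _ => inv_pos.2 (hβ ψ k))
      Finset.univ_nonempty) Finset.univ_nonempty
  set S := ∑ ψ, ∑ k, (p.β ψ k)⁻¹ with hSdef
  have hd : p.ξ * G (Ψ := Ψ) * p.Q * M ≠ 0 := by positivity
  -- With a common `M` the exponential undoes the logarithm, and each user receives a share of the
  -- power proportional to `β⁻¹`.
  have hterm : ∀ ψ k, p.N₀ * p.M ψ k * (Real.exp (p.ξ * G (Ψ := Ψ) * p.Q * M *
      Real.log (1 + p.Ptot * l / (M * p.N₀ * S)) / (p.ξ * G (Ψ := Ψ) * p.Q * p.M ψ k)) - 1) /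
        (p.β ψ k * l) = p.Ptot / S * (p.β ψ k)⁻¹ := by
    intro ψ k
    rw [hM, mul_div_cancel_left₀ _ hd, Real.exp_log (by positivity)]
    have := (hβ ψ k).ne'
    field_simp
    ring
  simp only [requiredPower, hterm, ← Finset.mul_sum]
  rw [← hSdef, div_mul_cancel₀ _ hS.ne']

variable {Ω : Type*} [MeasurableSpace Ω] {μ : Measure Ω} [IsProbabilityMeasure μ]
  {H : Ω → p.Channel}

lemma feasible_iff (P : p.Power) : p.Feasible P ↔
    (∀ (u : Ψ × Fin p.Q) q, 0 ≤ P u.1 u.2 q) ∧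
      ∑ u : Ψ × Fin p.Q, ∑ q, P u.1 u.2 q ≤ p.Ptot := by
  rw [Feasible, Fintype.sum_prod_type, Prod.forall]

lemma IsRayleigh.minAvgRate_eq (hH : p.IsRayleigh μ H) (hL : ∀ ψ, p.Mgrp ψ < p.L)
    (hβ : ∀ ψ k, 0 < p.β ψ k) (hN : 0 < p.N₀) {P : p.Power} (hP : p.Feasible P) :
    p.minAvgRate μ H P = ⨅ u : Ψ × Fin p.Q, ∑ q,
      p.ξ * streamRate μ H u.1 ⟨u.2, q⟩ (P u.1 u.2 q) := by
  simp_rw [minAvgRate, hH.avgUserRate_eq hβ hN hP.1 (hL _), Finset.mul_sum]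

lemma IsRayleigh.exists_isMMFOptimal [Nonempty Ψ] (hH : p.IsRayleigh μ H) (hQ : 0 < p.Q)
    (hL : ∀ ψ, p.Mgrp ψ < p.L) (hβ : ∀ ψ k, 0 < p.β ψ k) (hN : 0 < p.N₀) (hP : 0 < p.Ptot) :
    ∃ P, p.IsMMFOptimal μ H P := by
  have : Nonempty (Fin p.Q) := ⟨⟨0, hQ⟩⟩
  obtain ⟨P, hPf, hmax⟩ := exists_maxMin_allocation (ι := Ψ × Fin p.Q)
    (κ := fun u => Fin (p.M u.1 u.2))
    (g := fun u q x => p.ξ * streamRate μ H u.1 ⟨u.2, q⟩ x)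
    (fun u q => continuousOn_const.mul (hH.continuousOn_streamRate hβ hN (hL _) _)) hP.le
  have hf : p.Feasible (fun ψ k q => P (ψ, k) q) := (feasible_iff _).2 hPf
  refine ⟨fun ψ k q => P (ψ, k) q, hf, fun P' hP' => ?_⟩
  rw [hH.minAvgRate_eq hL hβ hN hf, hH.minAvgRate_eq hL hβ hN hP']
  exact hmax (fun u => P' u.1 u.2) ((feasible_iff _).1 hP')

lemma IsRayleigh.avgUserRate_eq_minAvgRate [Nonempty Ψ] (hH : p.IsRayleigh μ H) (hQ : 0 < p.Q)
    (hM : ∀ ψ k, 0 < p.M ψ k) (hL : ∀ ψ, p.Mgrp ψ < p.L) (hβ : ∀ ψ k, 0 < p.β ψ k)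
    (hN : 0 < p.N₀) (hξ : 0 < p.ξ) {P : p.Power} (hP : p.IsMMFOptimal μ H P) (ψ : Ψ)
    (k : Fin p.Q) : p.avgUserRate μ H P ψ k = p.minAvgRate μ H P := by
  have : Nonempty (Fin p.Q) := ⟨⟨0, hQ⟩⟩
  have : ∀ u : Ψ × Fin p.Q, Nonempty (Fin (p.M u.1 u.2)) := fun u => ⟨⟨0, hM _ _⟩⟩
  have hf := (feasible_iff _).1 hP.1
  rw [hH.minAvgRate_eq hL hβ hN hP.1, hH.avgUserRate_eq hβ hN hP.1.1 (hL _), Finset.mul_sum]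
  refine eq_iInf_of_maxMin (ι := Ψ × Fin p.Q) (κ := fun u => Fin (p.M u.1 u.2))
    (g := fun u q x => p.ξ * streamRate μ H u.1 ⟨u.2, q⟩ x) (P := fun u => P u.1 u.2)
    (fun u q => continuousOn_const.mul (hH.continuousOn_streamRate hβ hN (hL _) _))
    (fun u q x hx y hy h => mul_lt_mul_of_pos_left
      (hH.strictMonoOn_streamRate hβ hN (hL _) _ hx hy h) hξ)
    (fun u q => by simp) hf.1 hf.2 (fun P' hP' => ?_) (ψ, k)
  have hf' : p.Feasible (fun ψ k q => P' (ψ, k) q) := (feasible_iff _).2 hP'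
  have h := hP.2 _ hf'
  rwa [hH.minAvgRate_eq hL hβ hN hP.1, hH.minAvgRate_eq hL hβ hN hf'] at h

lemma IsRayleigh.avgSumRate_eq [Nonempty Ψ] (hH : p.IsRayleigh μ H) (hQ : 0 < p.Q)
    (hM : ∀ ψ k, 0 < p.M ψ k) (hL : ∀ ψ, p.Mgrp ψ < p.L) (hβ : ∀ ψ k, 0 < p.β ψ k)
    (hN : 0 < p.N₀) (hξ : 0 < p.ξ) {P : p.Power} (hP : p.IsMMFOptimal μ H P) :
    p.avgSumRate μ H P = G (Ψ := Ψ) * p.Q * p.minAvgRate μ H P := by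
  simp only [avgSumRate, hH.avgUserRate_eq_minAvgRate hQ hM hL hβ hN hξ hP, Finset.sum_const,
    Finset.card_univ, Fintype.card_fin, nsmul_eq_mul, G, mul_assoc]

/-- The power spent on a user is at least what its rate requires, if the mean gain is
`β (L - M_ψ + 1)`. -/
lemma IsRayleigh.le_sum_power (hH : p.IsRayleigh μ H) (hM : ∀ ψ k, 0 < p.M ψ k)
    (hL : ∀ ψ, p.Mgrp ψ < p.L) (hβ : ∀ ψ k, 0 < p.β ψ k) (hN : 0 < p.N₀) (hξ : 0 < p.ξ)
    {P : p.Power} (hP : ∀ ψ k q, 0 ≤ P ψ k q) (ψ : Ψ) (k : Fin p.Q) :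
    p.N₀ * p.M ψ k * (Real.exp (p.avgUserRate μ H P ψ k / (p.ξ * p.M ψ k)) - 1) /
      (p.β ψ k * (p.L - p.Mgrp ψ + 1)) ≤ ∑ q, P ψ k q := by
  have hL' : (p.Mgrp ψ : ℝ) < p.L := by exact_mod_cast hL ψ
  have hm : (0 : ℝ) < p.M ψ k := by exact_mod_cast hM ψ k
  set c := p.β ψ k * (p.L - p.Mgrp ψ + 1) with hc
  have hc0 : 0 < c := mul_pos (hβ _ _) (by linarith)
  have hS : 0 ≤ ∑ q, P ψ k q := Finset.sum_nonneg fun q _ => hP ψ k q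
  -- Concavity enters twice: over the fading for each stream, then over the streams of the user.
  have h1 : ∑ q, streamRate μ H ψ ⟨k, q⟩ (P ψ k q) ≤
      p.M ψ k * Real.log (1 + (∑ q, P ψ k q) * (c / p.N₀) / p.M ψ k) := by
    refine (Finset.sum_le_sum fun q _ =>
      hH.streamRate_le hβ hN (hL ψ) ⟨k, q⟩ (hP ψ k q)).trans ?_
    refine le_trans (le_of_eq ?_)
      (sum_log_one_add_mul_le (hM ψ k) (div_nonneg hc0.le hN.le) (hP ψ k))
    refine Finset.sum_congr rfl fun q _ => ?_
    simp only [← hc]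
    congr 2
    ring
  have h2 : p.avgUserRate μ H P ψ k / (p.ξ * p.M ψ k) ≤
      Real.log (1 + (∑ q, P ψ k q) * (c / p.N₀) / p.M ψ k) := by
    rw [hH.avgUserRate_eq hβ hN hP (hL ψ), mul_div_mul_left _ _ hξ.ne', div_le_iff₀ hm, mul_comm]
    exact h1
  have h3 := (Real.le_log_iff_exp_le (by positivity)).1 h2
  rw [div_le_iff₀ hc0]
  calc p.N₀ * p.M ψ k * (Real.exp (p.avgUserRate μ H P ψ k / (p.ξ * p.M ψ k)) - 1)
      ≤ p.N₀ * p.M ψ k * ((∑ q, P ψ k q) * (c / p.N₀) / p.M ψ k) :=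
        mul_le_mul_of_nonneg_left (by linarith) (by positivity)
    _ = (∑ q, P ψ k q) * c := by field_simp

/-- The allocation that spends `requiredPower (L - M_ψ) R`, uniformly over the streams of each
user, gives every user at least the rate `R / (G Q)`. -/
lemma IsRayleigh.exists_feasible_le_minAvgRate [Nonempty Ψ] (hH : p.IsRayleigh μ H)
    (hQ : 0 < p.Q) (hM : ∀ ψ k, 0 < p.M ψ k) (hL : ∀ ψ, p.Mgrp ψ < p.L)
    (hβ : ∀ ψ k, 0 < p.β ψ k) (hN : 0 < p.N₀) (hξ : 0 < p.ξ) {R : ℝ} (hR : 0 ≤ R)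
    (hRP : p.requiredPower (fun ψ => (p.L : ℝ) - p.Mgrp ψ) R ≤ p.Ptot) :
    ∃ P, p.Feasible P ∧ R / (G (Ψ := Ψ) * p.Q) ≤ p.minAvgRate μ H P := by
  have : Nonempty (Fin p.Q) := ⟨⟨0, hQ⟩⟩
  have hG : 0 < G (Ψ := Ψ) := Fintype.card_pos
  have hℓ : ∀ ψ, 0 < (p.L : ℝ) - p.Mgrp ψ := fun ψ =>
    sub_pos.2 (by exact_mod_cast hL ψ)
  set P : p.Power := fun ψ k _ =>
    p.N₀ * (Real.exp (R / (p.ξ * G (Ψ := Ψ) * p.Q * p.M ψ k)) - 1) /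
      (p.β ψ k * ((p.L : ℝ) - p.Mgrp ψ)) with hPdef
  have hP0 : ∀ ψ k q, 0 ≤ P ψ k q := by
    intro ψ k q
    have h1 : 0 ≤ R / (p.ξ * G (Ψ := Ψ) * p.Q * p.M ψ k) := by positivity
    have h2 := Real.add_one_le_exp (R / (p.ξ * G (Ψ := Ψ) * p.Q * p.M ψ k))
    exact div_nonneg (mul_nonneg hN.le (by linarith)) (mul_nonneg (hβ ψ k).le (hℓ ψ).le)
  have hf : p.Feasible P := by
    refine ⟨hP0, le_trans (le_of_eq ?_) hRP⟩
    refine Finset.sum_congr rfl fun ψ _ => Finset.sum_congr rfl fun k _ => ?_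
    simp only [hPdef, Finset.sum_const, Finset.card_univ, Fintype.card_fin, nsmul_eq_mul]
    ring
  refine ⟨P, hf, le_ciInf fun u => ?_⟩
  obtain ⟨ψ, k⟩ := u
  have hm : (0 : ℝ) < p.M ψ k := by exact_mod_cast hM ψ k
  have hstream : ∀ q, R / (p.ξ * G (Ψ := Ψ) * p.Q * p.M ψ k) ≤
      streamRate μ H ψ ⟨k, q⟩ (P ψ k q) := by
    intro q
    refine le_trans (le_of_eq ?_) (hH.le_streamRate hβ hN (hL ψ) ⟨k, q⟩ (hP0 ψ k q))
    -- The powers were chosen to make this an equality, so the lower bound on the stream rate is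
    -- exactly the target.
    have e : 1 + P ψ k q / p.N₀ * (p.β ψ k * (p.L - p.Mgrp ψ)) =
        Real.exp (R / (p.ξ * G (Ψ := Ψ) * p.Q * p.M ψ k)) := by
      simp only [hPdef]
      have := (hℓ ψ).ne'
      have := (hβ ψ k).ne'
      field_simp
      ring
    rw [e, Real.log_exp]
  change _ ≤ p.avgUserRate μ H P ψ k
  rw [hH.avgUserRate_eq hβ hN hP0 (hL ψ)]
  calc R / (G (Ψ := Ψ) * p.Q)
      = p.ξ * ∑ _q : Fin (p.M ψ k), R / (p.ξ * G (Ψ := Ψ) * p.Q * p.M ψ k) := by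
        simp only [Finset.sum_const, Finset.card_univ, Fintype.card_fin, nsmul_eq_mul]
        field_simp
    _ ≤ _ := mul_le_mul_of_nonneg_left (Finset.sum_le_sum fun q _ => hstream q) hξ.le

/-- Since every user has the rate `avgSumRate / (G Q)`, the per-user bounds `le_sum_power` add up to
`requiredPower` on one side and to the spent power on the other. -/
lemma IsRayleigh.requiredPower_avgSumRate_le [Nonempty Ψ] (hH : p.IsRayleigh μ H)
    (hQ : 0 < p.Q) (hM : ∀ ψ k, 0 < p.M ψ k) (hL : ∀ ψ, p.Mgrp ψ < p.L)
    (hβ : ∀ ψ k, 0 < p.β ψ k) (hN : 0 < p.N₀) (hξ : 0 < p.ξ) {P : p.Power}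
    (hP : p.IsMMFOptimal μ H P) :
    p.requiredPower (fun ψ => (p.L : ℝ) - p.Mgrp ψ + 1) (p.avgSumRate μ H P) ≤ p.Ptot := by
  have hG : 0 < G (Ψ := Ψ) := Fintype.card_pos
  refine le_trans (Finset.sum_le_sum fun ψ _ => Finset.sum_le_sum fun k _ => ?_) hP.1.2
  refine le_trans (le_of_eq ?_) (hH.le_sum_power hM hL hβ hN hξ hP.1.1 ψ k)
  rw [hH.avgSumRate_eq hQ hM hL hβ hN hξ hP,
    hH.avgUserRate_eq_minAvgRate hQ hM hL hβ hN hξ hP]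
  have e : (G (Ψ := Ψ) : ℝ) * p.Q * p.minAvgRate μ H P /
      (p.ξ * G (Ψ := Ψ) * p.Q * p.M ψ k) = p.minAvgRate μ H P / (p.ξ * p.M ψ k) := by
    have hm := hM ψ k
    field_simp
  rw [e]

end VCCParams

end

theorem theorem2 {Ψ : Type*} [Fintype Ψ] [Nonempty Ψ] (p : VCCParams Ψ)
    (hQ : 0 < p.Q) (hM : ∀ ψ k, 0 < p.M ψ k) (hL : ∀ ψ, p.Mgrp ψ < p.L)
    (hβ : ∀ ψ k, 0 < p.β ψ k) (hN : 0 < p.N₀) (hP : 0 < p.Ptot)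
    (hT : 0 < p.T) (hΘ : 0 ≤ p.Θ) (hξ : 0 < p.ξ)
    {Ω : Type*} [MeasurableSpace Ω] (μ : MeasureTheory.Measure Ω)
    [MeasureTheory.IsProbabilityMeasure μ] (H : Ω → p.Channel) (hH : p.IsRayleigh μ H) :
    -- the fading averages are finite
    (∀ P, p.Feasible P → ∀ ψ k,
      MeasureTheory.Integrable (fun ω => p.userRate P (H ω) ψ k) μ) ∧
    ∃ Rlow Rbar Rup : ℝ,
      -- `Rbar` is the MMF-optimized sum-rate, `Rlow` and `Rup` are the roots of the two equations
      (∀ R, p.IsMMFSumRate μ H R ↔ R = Rbar) ∧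
      (∀ R, p.LowerEq R ↔ R = Rlow) ∧
      (∀ R, p.UpperEq R ↔ R = Rup) ∧
      Rlow ≤ Rbar ∧ Rbar ≤ Rup ∧
      -- closed forms if all users have the same number of antennas
      (∀ M : ℕ, (∀ ψ k, p.M ψ k = M) →
        Rlow = p.ξ * VCCParams.G (Ψ := Ψ) * p.Q * M *
          Real.log (1 + p.Ptot * ((p.L : ℝ) - p.Q * M) /
            (M * p.N₀ * ∑ ψ, ∑ k, (p.β ψ k)⁻¹)) ∧
        Rup = p.ξ * VCCParams.G (Ψ := Ψ) * p.Q * M *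
          Real.log (1 + p.Ptot * ((p.L : ℝ) - p.Q * M + 1) /
            (M * p.N₀ * ∑ ψ, ∑ k, (p.β ψ k)⁻¹))) := by
  have : Nonempty (Fin p.Q) := ⟨⟨0, hQ⟩⟩
  have hℓ : ∀ ψ, 0 < (p.L : ℝ) - p.Mgrp ψ := fun ψ => sub_pos.2 (by exact_mod_cast hL ψ)
  have hG : 0 < VCCParams.G (Ψ := Ψ) := Fintype.card_pos
  refine ⟨fun P hPf ψ k => hH.integrable_userRate hβ hN hPf.1 (hL ψ) k, ?_⟩
  obtain ⟨hlow, Rlow, hRlow0, hRlow⟩ := VCCParams.requiredPower_root hQ hM hβ hN hP hξ hℓ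
  obtain ⟨hup, Rup, -, hRup⟩ := VCCParams.requiredPower_root (p := p)
    (ℓ := fun ψ => (p.L : ℝ) - p.Mgrp ψ + 1) hQ hM hβ hN hP hξ
    (fun ψ => add_pos (hℓ ψ) one_pos)
  obtain ⟨P, hPopt⟩ := hH.exists_isMMFOptimal hQ hL hβ hN hP
  -- `LowerEq` is by definition `requiredPower = Ptot` with gains `L - M_ψ`, and `UpperEq` the same
  -- with `L - M_ψ + 1`.
  have hlow_iff : ∀ R, p.LowerEq R ↔ R = Rlow := fun R =>
    ⟨fun h => hlow.injective (h.trans hRlow.symm), fun h => h ▸ hRlow⟩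
  have hup_iff : ∀ R, p.UpperEq R ↔ R = Rup := fun R =>
    ⟨fun h => hup.injective (h.trans hRup.symm), fun h => h ▸ hRup⟩
  refine ⟨Rlow, p.avgSumRate μ H P, Rup, fun R => ⟨?_, ?_⟩, hlow_iff, hup_iff, ?_, ?_, ?_⟩
  -- Two optimizers have the same minimum rate, hence the same sum-rate.
  · rintro ⟨P', hP', rfl⟩
    rw [hH.avgSumRate_eq hQ hM hL hβ hN hξ hP', hH.avgSumRate_eq hQ hM hL hβ hN hξ hPopt,
      le_antisymm (hPopt.2 _ hP'.1) (hP'.2 _ hPopt.1)]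
  · rintro rfl
    exact ⟨P, hPopt, rfl⟩
  · obtain ⟨P', hP', hle⟩ :=
      hH.exists_feasible_le_minAvgRate hQ hM hL hβ hN hξ hRlow0.le hRlow.le
    rw [hH.avgSumRate_eq hQ hM hL hβ hN hξ hPopt]
    have h := hle.trans (hPopt.2 P' hP')
    rw [div_le_iff₀ (by positivity)] at h
    linarith
  -- The optimal sum-rate requires at most `Ptot`, which is what `Rup` requires; strict monotonicity
  -- compares the two rates.
  · exact hup.le_iff_le.1
      ((hH.requiredPower_avgSumRate_le hQ hM hL hβ hN hξ hPopt).trans hRup.ge)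
  · intro M hMM
    obtain ⟨ψ₀⟩ := ‹Nonempty Ψ›
    obtain ⟨k₀⟩ := ‹Nonempty (Fin p.Q)›
    have hM0 : 0 < M := hMM ψ₀ k₀ ▸ hM ψ₀ k₀
    have hgrp : ∀ ψ, (p.Mgrp ψ : ℝ) = p.Q * M := fun ψ => by simp [VCCParams.Mgrp, hMM]
    have hl : 0 < (p.L : ℝ) - p.Q * M := hgrp ψ₀ ▸ hℓ ψ₀
    have : Nonempty Ψ := ⟨ψ₀⟩
    constructor
    · refine ((hlow_iff _).1 ?_).symm
      have h := VCCParams.requiredPower_closed_form hQ hβ hN hP hξ hM0 hMM hl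
      simp only [VCCParams.requiredPower] at h
      simpa only [VCCParams.LowerEq, hgrp] using h
    · refine ((hup_iff _).1 ?_).symm
      have h := VCCParams.requiredPower_closed_form hQ hβ hN hP hξ hM0 hMM (add_pos hl one_pos)
      simp only [VCCParams.requiredPower] at h
      simpa only [VCCParams.UpperEq, hgrp] using h
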